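/- Let $M$ be a smooth ($C^\infty$, Hausdorff, second countable, without boundary) manifold of finite dimension $n\ge 1$. Put $T^0M=M$ and $T^{r+1}M=T(T^rM)$, let $\pi_r\colon T^{r+1}M\to T^rM$ be the canonical projection, and let $T^{r+1}M\setminus\{0\}$ be the set of all $\xi\in T^{r+1}M$ whose image under the tangent map $D\pi_{T^rM\to M}\colon T^{r+1}M\to TM$ of the projection $T^rM\to M$ is nonzero. For a curve $\gamma$ in $T^rM$, $\gamma'$ denotes its tangent curve in $T^{r+1}M$. Let $\kappa_{r+2}\colon T^{r+2}M\to T^{r+2}M$ be the canonical involution, i.e. the diffeomorphism with $\partial_t\partial_s c=\kappa_{r+2}\circ\partial_s\partial_t c$ for all smooth maps $c(t,s)$ into $T^rM$; in canonical coordinates $\kappa_{r+2}(x,y,X,Y)=(x,X,y,Y)$. A spray on $T^rM$ is a smooth vector field $S\colon T^{r+1}M\setminus\{0\}\to T^{r+2}M$ with $D\pi_r\circ S=\mathrm{id}$ and $[E,S]=S$, where $E(\xi)=\partial_s((1+s)\xi)|_{s=0}$ is the Liouville vector field on $T^{r+1}M$. Its complete lift is the spray $S^c=D\kappa_{r+2}\circ\kappa_{r+3}\circ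 DS\circ\kappa_{r+2}$ on $T^{r+1}M$. For an open interval $I$, a geodesic of $S$ is a smooth curve $\gamma\colon I\to T^rM$ with $\gamma'(t)\in T^{r+1}M\setminus\{0\}$ for all $t\in I$ and $\gamma''=S\circ\gamma'$. A Jacobi field along a geodesic $\gamma\colon I\to T^rM$ of $S$ is a geodesic $J\colon I\to T^{r+1}M$ of $S^c$ with $\pi_r\circ J=\gamma$. A geodesic variation of $\gamma$ is a smooth map $V\colon I\times(-\varepsilon,\varepsilon)\to T^rM$, $\varepsilon>0$, such that $V(t,0)=\gamma(t)$ for all $t\in I$ and $t\mapsto V(t,s)$ is a geodesic of $S$ for each $s\in(-\varepsilon,\varepsilon)$. On a closed interval $I$, $J$ is a Jacobi field along $\gamma$ if $J$ and $\gamma$ extend to an open interval containing $I$ on which the extension of $J$ is a Jacobi field along the extension of $\gamma$; and a map $V\colon I\times(-\varepsilon,\varepsilon)\to T^rM$ is a geodesic variation of $\gamma$ if $V$ agrees, on the common domain, with a geodesic variation $V^*\colon I^*\times(-\varepsilon^*,\varepsilon^*)\to T^rM$ of an extension of $\gamma$ to an open interval $I^*\supset I$. **Proposition.** Let $S$ be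 a spray on $T^rM$, $r\ge 0$, let $I\subset\mathbb R$ be a nonempty open or closed interval, let $J\colon I\to T^{r+1}M$ be a curve, and let $\gamma=\pi_r\circ J$. (i) If there is a geodesic variation $V\colon I\times(-\varepsilon,\varepsilon)\to T^rM$ of $\gamma$ with $J(t)=\partial_sV(t,s)|_{s=0}$ for all $t\in I$, then $J$ is a Jacobi field along $\gamma$. (ii) Conversely, if $J$ is a Jacobi field along $\gamma$ and $I$ is compact, then there exist $\varepsilon>0$ and a geodesic variation $V\colon I\times(-\varepsilon,\varepsilon)\to T^rM$ of $\gamma$ with $J(t)=\partial_sV(t,s)|_{s=0}$ for all $t\in I$. -/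

import Mathlib

open Set Filter Topology
open scoped Manifold ContDiff

universe u

/-- A bundled `C^∞` manifold without boundary, modelled on a finite-dimensional real normed
space. The bundling serves only to iterate the tangent bundle construction. -/
structure Mfd where
  /-- the model vector space -/
  E : Type
  /-- the model space of the charts -/
  H : Type
  /-- the manifold itself -/
  carrier : Type u
  [normedAddCommGroup : NormedAddCommGroup E]
  [normedSpace : NormedSpace ℝ E]
  [finiteDimensional : FiniteDimensional ℝ E]
  [topH : TopologicalSpace H]
  /-- the model with corners (in fact without boundary) -/
  I : ModelWithCorners ℝ E H
  [boundaryless : I.Boundaryless]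
  [top : TopologicalSpace carrier]
  [charted : ChartedSpace H carrier]
  [isManifold : IsManifold I ∞ carrier]

noncomputable section

section

variable {E : Type*} [NormedAddCommGroup E] [NormedSpace ℝ E]

theorem pderiv_snd {F : ℝ × ℝ → E} {t s : ℝ} (hF : DifferentiableAt ℝ F (t, s)) :
    deriv (fun s' => F (t, s')) s = fderiv ℝ F (t, s) (0, 1) := by
  have h1 : HasDerivAt (fun s' : ℝ => (t, s')) ((0 : ℝ), (1 : ℝ)) s :=
    (hasDerivAt_const s t).prodMk (hasDerivAt_id s)
  exact (hF.hasFDerivAt.comp_hasDerivAt s h1).deriv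

theorem pderiv_fst {F : ℝ × ℝ → E} {t s : ℝ} (hF : DifferentiableAt ℝ F (t, s)) :
    deriv (fun t' => F (t', s)) t = fderiv ℝ F (t, s) (1, 0) := by
  have h1 : HasDerivAt (fun t' : ℝ => (t', s)) ((1 : ℝ), (0 : ℝ)) t :=
    (hasDerivAt_id t).prodMk (hasDerivAt_const t s)
  exact (hF.hasFDerivAt.comp_hasDerivAt t h1).deriv

theorem eventually_slice_fst {P : ℝ × ℝ → Prop} {t s : ℝ} (h : ∀ᶠ q in 𝓝 (t, s), P q) :
    ∀ᶠ t' in 𝓝 t, P (t', s) :=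
  (Continuous.tendsto (by fun_prop : Continuous fun t' : ℝ => (t', s)) t).eventually h

theorem eventually_slice_snd {P : ℝ × ℝ → Prop} {t s : ℝ} (h : ∀ᶠ q in 𝓝 (t, s), P q) :
    ∀ᶠ s' in 𝓝 s, P (t, s') :=
  (Continuous.tendsto (by fun_prop : Continuous fun s' : ℝ => (t, s')) s).eventually h

theorem pderiv_comm {F : ℝ × ℝ → E} {t s : ℝ} (hF : ContDiffAt ℝ 2 F (t, s)) :
    DifferentiableAt ℝ (fun t' => deriv (fun s' => F (t', s')) s) t ∧
    DifferentiableAt ℝ (fun s' => deriv (fun t' => F (t', s')) t) s ∧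
    deriv (fun t' => deriv (fun s' => F (t', s')) s) t =
      deriv (fun s' => deriv (fun t' => F (t', s')) t) s := by
  have hd : ∀ᶠ q in 𝓝 (t, s), DifferentiableAt ℝ F q :=
    (hF.eventually (by simp)).mono fun q hq => hq.differentiableAt (by simp)
  have e1 : (fun t' => deriv (fun s' => F (t', s')) s) =ᶠ[𝓝 t]
      fun t' => (fun q => fderiv ℝ F q (0, 1)) (t', s) :=
    (eventually_slice_fst hd).mono fun t' h => pderiv_snd h
  have e2 : (fun s' => deriv (fun t' => F (t', s')) t) =ᶠ[𝓝 s]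
      fun s' => (fun q => fderiv ℝ F q (1, 0)) (t, s') :=
    (eventually_slice_snd hd).mono fun s' h => pderiv_fst h
  have hD : DifferentiableAt ℝ (fderiv ℝ F) (t, s) :=
    (hF.fderiv_right (m := 1) (by norm_num)).differentiableAt (by simp)
  have hD' : ∀ v : ℝ × ℝ, HasFDerivAt (fun q => fderiv ℝ F q v)
      ((fderiv ℝ (fderiv ℝ F) (t, s)).flip v) (t, s) := fun v => by
    simpa using hD.hasFDerivAt.clm_apply (hasFDerivAt_const v (t, s))
  have hs := hF.isSymmSndFDerivAt (by simp)
  refine ⟨DifferentiableAt.congr_of_eventuallyEq ?_ e1,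
    DifferentiableAt.congr_of_eventuallyEq ?_ e2, ?_⟩
  · exact DifferentiableAt.comp (f := fun t' : ℝ => (t', s)) t (hD' _).differentiableAt (by fun_prop)
  · exact DifferentiableAt.comp (f := fun s' : ℝ => (t, s')) s (hD' _).differentiableAt (by fun_prop)
  · rw [e1.deriv_eq, e2.deriv_eq, pderiv_fst (hD' _).differentiableAt,
      pderiv_snd (hD' _).differentiableAt, (hD' _).fderiv, (hD' _).fderiv]
    exact (hs (1, 0) (0, 1))

end

section

variable {E H M : Type*} [NormedAddCommGroup E] [NormedSpace ℝ E] [TopologicalSpace H]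
  {I : ModelWithCorners ℝ E H} [TopologicalSpace M] [ChartedSpace H M]

/-- The tangent curve `γ' : ℝ → TM` of a curve `γ` in a manifold `M`. -/
def velocity (I : ModelWithCorners ℝ E H) (γ : ℝ → M) : ℝ → TangentBundle I M :=
  fun t => ⟨γ t, mfderiv 𝓘(ℝ, ℝ) I γ t (1 : ℝ)⟩

theorem velocity_eq {γ : ℝ → M} {t : ℝ} (h : MDifferentiableAt 𝓘(ℝ, ℝ) I γ t) :
    velocity I γ t = ⟨γ t, deriv (extChartAt I (γ t) ∘ γ) t⟩ := by
  unfold velocity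
  rw [h.mfderiv]
  simp only [writtenInExtChartAt, mfld_simps, fderivWithin_univ]
  rfl

variable [IsManifold I ∞ M]

theorem extChartAt_velocity {γ : ℝ → M} {t : ℝ} (h : MDifferentiableAt 𝓘(ℝ, ℝ) I γ t) (p : TangentBundle I M)
    (hp : γ t ∈ (chartAt H p.1).source) :
    extChartAt I.tangent p (velocity I γ t) = (extChartAt I p.1 (γ t), deriv (extChartAt I p.1 ∘ γ) t) := by
  have h1 : MDifferentiableAt I 𝓘(ℝ,E) (extChartAt I p.1) (γ t) := mdifferentiableAt_extChartAt hp
  refine Prod.ext rfl ?_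
  have h2 := mfderiv_comp_apply t h1 h (1:ℝ)
  have h3 : mfderiv 𝓘(ℝ,ℝ) 𝓘(ℝ,E) (extChartAt I p.1 ∘ γ) t (1:ℝ) = deriv (extChartAt I p.1 ∘ γ) t := by
    rw [mfderiv_eq_fderiv]; rfl
  rw [h3, h1.mfderiv] at h2
  exact h2.symm

/-- The tangent curve of `t ↦ ∂ₛ δ(t, s)` in coordinates. -/
theorem velocity_velocity {δ : ℝ → ℝ → M} {t s : ℝ} (hd : ∀ᶠ t' in 𝓝 t, MDifferentiableAt 𝓘(ℝ, ℝ) I (δ t') s)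
    (hc : MDifferentiableAt 𝓘(ℝ, ℝ) I (fun t' => δ t' s) t)
    (h2 : DifferentiableAt ℝ (fun t' => deriv (fun s' => extChartAt I (δ t s) (δ t' s')) s) t) :
    velocity I.tangent (fun t' => velocity I (δ t') s) t =
      ⟨⟨δ t s, deriv (fun s' => extChartAt I (δ t s) (δ t s')) s⟩,
        (deriv (fun t' => extChartAt I (δ t s) (δ t' s)) t,
          deriv (fun t' => deriv (fun s' => extChartAt I (δ t s) (δ t' s')) s) t)⟩ := by
  have hsrc : ∀ᶠ t' in 𝓝 t, δ t' s ∈ (chartAt H (δ t s)).source :=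
    hc.continuousAt.eventually ((chartAt H (δ t s)).open_source.mem_nhds (mem_chart_source H _))
  have hev : (extChartAt I.tangent (velocity I (δ t) s) ∘ fun t' => velocity I (δ t') s) =ᶠ[𝓝 t]
      fun t' => (extChartAt I (δ t s) (δ t' s),
        deriv (fun s' => extChartAt I (δ t s) (δ t' s')) s) := by
    filter_upwards [hd, hsrc] with t' h1 h2
    exact extChartAt_velocity h1 (velocity I (δ t) s) h2
  have hda : DifferentiableAt ℝ (fun t' => extChartAt I (δ t s) (δ t' s)) t := by
    have := (mdifferentiableAt_extChartAt (I := I) (mem_chart_source H (δ t s))).comp t hc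
    exact this.differentiableAt
  have hdiff : DifferentiableAt ℝ
      (extChartAt I.tangent (velocity I (δ t) s) ∘ fun t' => velocity I (δ t') s) t :=
    (hda.prodMk h2).congr_of_eventuallyEq hev
  have hm : MDifferentiableAt 𝓘(ℝ, ℝ) I.tangent (fun t' => velocity I (δ t') s) t := by
    rw [mdifferentiableAt_iff_target]
    refine ⟨?_, hdiff.mdifferentiableAt⟩
    have hs2 : ∀ᶠ t' in 𝓝 t, velocity I (δ t') s ∈ (chartAt (ModelProd H E) (velocity I (δ t) s)).source :=
      hsrc.mono fun t' h => (TangentBundle.mem_chart_source_iff _ _).2 h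
    exact ((chartAt (ModelProd H E) (velocity I (δ t) s)).tendsto_extend_comp_iff (I := I.tangent)
      hs2 (mem_chart_source _ _)).1 hdiff.continuousAt
  have hder : deriv (extChartAt I.tangent (velocity I (δ t) s) ∘ fun t' => velocity I (δ t') s) t =
      (deriv (fun t' => extChartAt I (δ t s) (δ t' s)) t,
          deriv (fun t' => deriv (fun s' => extChartAt I (δ t s) (δ t' s')) s) t) := by
    rw [hev.deriv_eq]
    exact (hda.hasDerivAt.prodMk h2.hasDerivAt).deriv
  refine (velocity_eq hm).trans ?_
  refine Eq.trans ?_ (congrArg (fun w : E × E =>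
    (⟨⟨δ t s, deriv (fun s' => extChartAt I (δ t s) (δ t s')) s⟩, w⟩ :
      TangentBundle I.tangent (TangentBundle I M))) hder)
  exact congrArg (fun q : TangentBundle I M => (⟨q, (show E × E from
    deriv (extChartAt I.tangent (velocity I (δ t) s) ∘ fun t' => velocity I (δ t') s) t)⟩ :
      TangentBundle I.tangent (TangentBundle I M))) (velocity_eq hd.self_of_nhds)

theorem velocity_velocity_comm {c : ℝ × ℝ → M} {t s : ℝ} (hc : ContMDiffAt 𝓘(ℝ, ℝ × ℝ) I ∞ c (t, s)) :
    ∃ x y v w, velocity I.tangent (fun t' => velocity I (fun s' => c (t', s')) s) t =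
      (⟨⟨x, y⟩, (v, w)⟩ : TangentBundle I.tangent (TangentBundle I M)) ∧
      velocity I.tangent (fun s' => velocity I (fun t' => c (t', s')) t) s = ⟨⟨x, v⟩, (y, w)⟩ := by
  have hev : ∀ᶠ q in 𝓝 (t, s), MDifferentiableAt 𝓘(ℝ, ℝ × ℝ) I c q :=
    ((contMDiffAt_iff_contMDiffAt_nhds (n := 1) (by simp)).1 (hc.of_le (by simp))).mono
      fun q hq => hq.mdifferentiableAt (by simp)
  have hF : ContDiffAt ℝ 2 (fun q => extChartAt I (c (t, s)) (c q)) (t, s) := by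
    have h1 := (contMDiffAt_extChartAt (I := I) (n := ∞) (x := c (t, s))).comp (t, s) hc
    exact h1.contDiffAt.of_le (WithTop.coe_le_coe.2 le_top)
  obtain ⟨h1, h2, h3⟩ := pderiv_comm hF
  have m1 : ∀ q : ℝ × ℝ, MDifferentiableAt 𝓘(ℝ, ℝ × ℝ) I c q →
      MDifferentiableAt 𝓘(ℝ, ℝ) I (fun t' => c (t', q.2)) q.1 := fun q hq =>
    MDifferentiableAt.comp (g := c) (f := fun t' : ℝ => (t', q.2)) q.1 hq
      (DifferentiableAt.mdifferentiableAt (by fun_prop))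
  have m2 : ∀ q : ℝ × ℝ, MDifferentiableAt 𝓘(ℝ, ℝ × ℝ) I c q →
      MDifferentiableAt 𝓘(ℝ, ℝ) I (fun s' => c (q.1, s')) q.2 := fun q hq =>
    MDifferentiableAt.comp (g := c) (f := fun s' : ℝ => (q.1, s')) q.2 hq
      (DifferentiableAt.mdifferentiableAt (by fun_prop))
  have e1 := velocity_velocity (I := I) (δ := fun t' s' => c (t', s')) (t := t) (s := s)
    ((eventually_slice_fst hev).mono fun t' h => m2 _ h) (m1 _ hev.self_of_nhds) h1
  have e2 := velocity_velocity (I := I) (δ := fun s' t' => c (t', s')) (t := s) (s := t)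
    ((eventually_slice_snd hev).mono fun t' h => m1 _ h) (m2 _ hev.self_of_nhds) h2
  refine ⟨_, _, _, _, e1, e2.trans ?_⟩
  rw [h3]
  rfl

end

namespace Mfd

attribute [instance] normedAddCommGroup normedSpace finiteDimensional topH boundaryless top
  charted isManifold

instance : CoeSort Mfd.{u} (Type u) := ⟨Mfd.carrier⟩

/-- An `n`-dimensional smooth manifold `M`, bundled. -/
def of (n : ℕ) (M : Type u) [TopologicalSpace M] [ChartedSpace (EuclideanSpace ℝ (Fin n)) M]
    [IsManifold (𝓡 n) ∞ M] : Mfd.{u} where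
  E := EuclideanSpace ℝ (Fin n)
  H := EuclideanSpace ℝ (Fin n)
  carrier := M
  I := 𝓡 n

/-- The tangent bundle `TX` of a manifold `X`, as a manifold. -/
def tangent (X : Mfd.{u}) : Mfd.{u} where
  E := X.E × X.E
  H := ModelProd X.H X.E
  carrier := TangentBundle X.I X
  I := X.I.tangent

/-- The iterated tangent bundles: `T⁰X = X` and `T^{r+1}X = T(T^rX)`. -/
def iter (X : Mfd.{u}) : ℕ → Mfd.{u}
  | 0 => X
  | r + 1 => (iter X r).tangent

/-- The canonical projection `TX → X`. -/
def proj (X : Mfd.{u}) : X.tangent → X := fun ξ => ξ.1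

/-- The canonical projection `T^rX → X`. -/
def toBase (X : Mfd.{u}) : (r : ℕ) → X.iter r → X
  | 0 => id
  | r + 1 => toBase X r ∘ (X.iter r).proj

variable {X Y B : Mfd.{u}}

/-- The tangent map `Df : TX → TY` of a map `f : X → Y`. -/
def D (f : X → Y) : X.tangent → Y.tangent := tangentMap X.I Y.I f

/-- The tangent curve `γ' : ℝ → TX` of a curve `γ` in `X`. -/
def vel (γ : ℝ → X) : ℝ → X.tangent :=
  velocity X.I γ

/-- The canonical involution `κ : TTX → TTX`, given by `(x, y, X, Y) ↦ (x, X, y, Y)` in canonical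
coordinates. (In Mathlib, a tangent vector at a point is its coordinate vector in the preferred
chart there, and the preferred chart of `TX` at `(x, y)` is the one induced by the preferred chart
of `X` at `x`, so the definition is this formula in the coordinates induced by that chart.
See `flip_vel_vel` below for the invariant characterization.) -/
def flip (X : Mfd.{u}) : X.tangent.tangent → X.tangent.tangent :=
  fun ξ => ⟨(⟨ξ.1.1, (show X.E × X.E from ξ.2).1⟩ : TangentBundle X.I X),
    (show X.E × X.E from ((show X.E from ξ.1.2), (show X.E × X.E from ξ.2).2))⟩

/-- The defining property of the canonical involution: `∂ₜ ∂ₛ c = κ ∘ ∂ₛ ∂ₜ c` for all smooth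
`c`, defined near `(t, s)`, with values in `X`. -/
theorem flip_vel_vel {c : ℝ × ℝ → X} {t s : ℝ}
    (hc : ContMDiffAt 𝓘(ℝ, ℝ × ℝ) X.I ∞ c (t, s)) :
    vel (X := X.tangent) (fun t' => vel (fun s' => c (t', s')) s) t =
      X.flip (vel (X := X.tangent) (fun s' => vel (fun t' => c (t', s')) t) s) := by
  obtain ⟨x, y, v, w, h1, h2⟩ := velocity_velocity_comm hc
  exact h1.trans (congrArg X.flip h2).symm

/-- The Liouville vector field `E(ξ) = ∂ₛ ((1 + s) ξ)` at `s = 0` on `TX`. -/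
def liouville (X : Mfd.{u}) : X.tangent → X.tangent.tangent :=
  fun ξ => vel (X := X.tangent)
    (fun s => (⟨ξ.1, (1 + s) • ξ.2⟩ : TangentBundle X.I X)) 0

/-- The vector part of a map `A : X → TX`. If `A` is a vector field on `U` (that is,
`X.proj (A x) = x` for `x ∈ U`), this is `A` on `U` as a dependent function. -/
def vec (A : X → X.tangent) : (x : X) → TangentSpace X.I x := fun x => (show X.E from (A x).2)

/-- For the projection `p : X → B` of an iterated tangent bundle `X = T^rB` to its base, this is
the slashed tangent bundle `T^{r+1}B∖{0} ⊆ T^{r+1}B = TX`: the set of all `ξ` with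
`Dp(ξ) ≠ 0`. -/
def slashed (p : X → B) : Set X.tangent := {ξ | (D p ξ).2 ≠ 0}

/-- Sprays on `X = T^rB`, where `p : X → B` is the projection: vector fields on the slashed
tangent bundle `T^{r+1}B∖{0}`, given by a map `S` whose values off that set are
irrelevant. -/
structure IsSpray (p : X → B) (S : X.tangent → X.tangent.tangent) : Prop where
  smooth : ContMDiffOn X.tangent.I X.tangent.tangent.I ∞ S (slashed p)
  vectorField : ∀ ξ ∈ slashed p, X.tangent.proj (S ξ) = ξ
  secondOrder : ∀ ξ ∈ slashed p, D X.proj (S ξ) = ξ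
  /-- `[E, S] = S` for the Liouville vector field `E` -/
  homogeneous : ∀ ξ ∈ slashed p,
    VectorField.mlieBracket X.tangent.I (vec X.liouville) (vec S) ξ = vec S ξ

/-- The complete lift `S^c = Dκ ∘ κ ∘ DS ∘ κ` of a spray `S` on `X`. It is a spray on `TX`. -/
def completeLift (S : X.tangent → X.tangent.tangent) :
    X.tangent.tangent → X.tangent.tangent.tangent :=
  D X.flip ∘ X.tangent.flip ∘ D S ∘ X.flip

/-- `γ : I → X` is a geodesic of the spray `S` on `X = T^rB`, where `I` is an open interval:
`γ` is smooth and regular (that is, `γ'` lies in the slashed tangent bundle), and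
`γ'' = S ∘ γ'`. -/
structure IsGeodesicOn (p : X → B) (S : X.tangent → X.tangent.tangent) (γ : ℝ → X)
    (I : Set ℝ) : Prop where
  smooth : ContMDiffOn 𝓘(ℝ, ℝ) X.I ∞ γ I
  regular : ∀ t ∈ I, vel γ t ∈ slashed p
  eq : ∀ t ∈ I, vel (vel γ) t = S (vel γ t)

/-- `J : I → TX` is a Jacobi field along the geodesic `γ : I → X` of `S`, where `I` is an open
interval: `J` is a geodesic of `S^c` over `γ`. -/
structure IsJacobiFieldOn (p : X → B) (S : X.tangent → X.tangent.tangent) (γ : ℝ → X)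
    (J : ℝ → X.tangent) (I : Set ℝ) : Prop where
  geodesic : IsGeodesicOn p S γ I
  lift : IsGeodesicOn (p ∘ X.proj) (completeLift S) J I
  proj_eq : ∀ t ∈ I, X.proj (J t) = γ t

/-- Jacobi fields on an open or closed interval `I`: if `I` is closed, then `J` is required to
extend to a Jacobi field on an open interval. -/
def IsJacobiField (p : X → B) (S : X.tangent → X.tangent.tangent) (γ : ℝ → X)
    (J : ℝ → X.tangent) (I : Set ℝ) : Prop :=
  (IsOpen I ∧ IsJacobiFieldOn p S γ J I) ∨
  (IsClosed I ∧ ∃ (I' : Set ℝ) (γ' : ℝ → X) (J' : ℝ → X.tangent),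
    IsOpen I' ∧ I'.OrdConnected ∧ I ⊆ I' ∧ EqOn γ γ' I ∧ EqOn J J' I ∧
    IsJacobiFieldOn p S γ' J' I')

/-- `V : I × (-ε, ε) → X` is a geodesic variation of `γ : I → X`, where `I` is an open
interval. -/
structure IsGeodesicVariationOn (p : X → B) (S : X.tangent → X.tangent.tangent) (γ : ℝ → X)
    (I : Set ℝ) (ε : ℝ) (V : ℝ × ℝ → X) : Prop where
  smooth : ContMDiffOn 𝓘(ℝ, ℝ × ℝ) X.I ∞ V (I ×ˢ Ioo (-ε) ε)
  base : ∀ t ∈ I, V (t, 0) = γ t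
  geodesic : ∀ s ∈ Ioo (-ε) ε, IsGeodesicOn p S (fun t => V (t, s)) I

/-- Geodesic variations `V : I × (-ε, ε) → X` on an open or closed interval `I`: if `I` is
closed, then `V` is required to agree, on the common domain, with a geodesic variation
`V' : I' × (-ε', ε') → X` for some open interval `I' ⊇ I`. -/
def IsGeodesicVariation (p : X → B) (S : X.tangent → X.tangent.tangent) (γ : ℝ → X)
    (I : Set ℝ) (ε : ℝ) (V : ℝ × ℝ → X) : Prop :=
  (IsOpen I ∧ IsGeodesicVariationOn p S γ I ε V) ∨
  (IsClosed I ∧ ∃ (I' : Set ℝ) (γ' : ℝ → X) (ε' : ℝ) (V' : ℝ × ℝ → X),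
    IsOpen I' ∧ I'.OrdConnected ∧ I ⊆ I' ∧ 0 < ε' ∧ EqOn γ γ' I ∧
    EqOn V V' (I ×ˢ (Ioo (-ε) ε ∩ Ioo (-ε') ε')) ∧
    IsGeodesicVariationOn p S γ' I' ε' V')

end Mfd

end

/-! Write κ for the canonical involution and ∂ for tangent vectors in one variable.

(i) Let V be a geodesic variation, T = ∂ₜV and J = ∂ₛV at s = 0. The geodesic equation is ∂ₜT = S ∘
T for every s. Differentiating it in s at s = 0 gives ∂ₛ∂ₜT = DS(∂ₛT). Exchanging derivatives costs
one κ each time: J' = κ(∂ₛT) and ∂ₜ∂ₛT = κ(∂ₛ∂ₜT). Hence J'' = Dκ(∂ₜ∂ₛT) = Dκ κ DS κ (J') = S^c(J').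
This is `IsGeodesicVariationOn.isJacobiFieldOn`.

(ii) Velocities of geodesics of S are integral curves of S in the open slashed bundle, and likewise
for S^c. Choose a curve w with w'(0) = κ(J'(a)), so that w(0) = γ'(a), and move it by the flow of S
along all of γ (`exists_integralFamily`). The projection V of this family is a geodesic variation of
γ. By (i) its variation field is a Jacobi field; its velocity at a is J'(a) by the choice of w, so
it equals J by uniqueness of integral curves of S^c (`eqOn_of_velocity_eq`). This is
`IsJacobiFieldOn.exists_variation`. Compactness of I ensures that one ε serves all times.

The analytic input is smooth dependence of solutions on time and initial value
(`exists_flow_of_contDiff`), obtained from the inverse function theorem in a Banach space of curves.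
The geometric input is that κ is smooth and exchanges the two projections TTX → TX
(`contMDiff_flip`, `proj_flip`). -/

noncomputable section

/-! ### Postcomposition as a smooth map on spaces of continuous functions -/

section Postcomposition

variable {K : Type} [TopologicalSpace K] [CompactSpace K]
  {E F : Type} [NormedAddCommGroup E] [NormedSpace ℝ E] [NormedAddCommGroup F] [NormedSpace ℝ F]

/-- Pointwise application of a continuous family of linear maps, as a bounded bilinear map. -/
def ContinuousMap.pointwiseApply (K E F : Type) [TopologicalSpace K] [CompactSpace K]
    [NormedAddCommGroup E] [NormedSpace ℝ E] [NormedAddCommGroup F] [NormedSpace ℝ F] :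
    C(K, E →L[ℝ] F) →L[ℝ] C(K, E) →L[ℝ] C(K, F) :=
  LinearMap.mkContinuous₂
    (LinearMap.mk₂ ℝ (fun (A : C(K, E →L[ℝ] F)) (h : C(K, E)) =>
        (⟨fun k => A k (h k), A.continuous.clm_apply h.continuous⟩ : C(K, F)))
      (fun _ _ _ => by ext; simp) (fun _ _ _ => by ext; simp)
      (fun _ _ _ => by ext; simp) (fun _ _ _ => by ext; simp)) 1
    (fun A h => by
      rw [ContinuousMap.norm_le _ (by positivity)]
      intro k
      rw [one_mul]
      exact ((A k).le_opNorm _).trans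
        (mul_le_mul (A.norm_coe_le_norm k) (h.norm_coe_le_norm k) (norm_nonneg _) (norm_nonneg A)))

/-- The pointwise mean value inequality gives the remainder estimate, provided one δ serves all
points of K. Such a δ comes from continuity of `β ↦ fderiv ℝ f ∘ β` in the sup norm, tested on
translates of `α` by constants. -/
theorem ContinuousMap.hasFDerivAt_postcomp {f : E → F} (hf : ContDiff ℝ 1 f) (α : C(K, E)) :
    HasFDerivAt (fun β : C(K, E) => (⟨f, hf.continuous⟩ : C(E, F)).comp β)
      (ContinuousMap.pointwiseApply K E F
        ((⟨fderiv ℝ f, hf.continuous_fderiv (by simp)⟩ : C(E, E →L[ℝ] F)).comp α)) α := by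
  rw [hasFDerivAt_iff_isLittleO_nhds_zero, Asymptotics.isLittleO_iff]
  intro c hc
  have hcont : Continuous fun β : C(K, E) =>
      (⟨fderiv ℝ f, hf.continuous_fderiv (by simp)⟩ : C(E, E →L[ℝ] F)).comp β :=
    ContinuousMap.continuous_postcomp _
  obtain ⟨δ, hδ, hball⟩ := (Metric.continuous_iff (α := C(K, E)) (β := C(K, E →L[ℝ] F))).1 hcont α c hc
  filter_upwards [Metric.ball_mem_nhds (0 : C(K, E)) hδ] with h hh
  rw [mem_ball_zero_iff] at hh
  rw [ContinuousMap.norm_le _ (by positivity)]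
  intro k
  have hb : ∀ z ∈ Metric.ball (α k) δ, ‖fderiv ℝ f z - fderiv ℝ f (α k)‖ ≤ c := by
    intro z hz
    have h1 : dist (α + ContinuousMap.const K (z - α k)) α < δ := by
      rw [dist_eq_norm, add_sub_cancel_left]
      refine lt_of_le_of_lt ((ContinuousMap.norm_le _ (norm_nonneg (z - α k))).2 fun _ => le_rfl) ?_
      rwa [← dist_eq_norm]
    have h2 := (ContinuousMap.dist_lt_iff hc).1 (hball _ h1) k
    rw [dist_eq_norm] at h2
    simpa using h2.le
  have hm := (convex_ball (α k) δ).norm_image_sub_le_of_norm_fderiv_le' (𝕜 := ℝ) (f := f)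
    (fun z _ => (hf.differentiable (by simp)) z) hb (Metric.mem_ball_self hδ)
    (y := α k + h k) (by
      rw [mem_ball_iff_norm, add_sub_cancel_left]
      exact (h.norm_coe_le_norm k).trans_lt hh)
  rw [add_sub_cancel_left] at hm
  exact hm.trans (mul_le_mul_of_nonneg_left (h.norm_coe_le_norm k) hc.le)

/-- Postcomposition with a smooth map is a smooth map between spaces of continuous functions on
a compact space. -/
theorem ContinuousMap.contDiff_postcomp {f : E → F} (hf : ContDiff ℝ ∞ f) :
    ContDiff ℝ ∞ (fun β : C(K, E) => (⟨f, hf.continuous⟩ : C(E, F)).comp β) := by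
  rw [contDiff_infty]
  intro n
  -- The derivative is a bounded bilinear map applied to postcomposition with `fderiv ℝ f`, whose
  -- codomain is `E →L[ℝ] F`; hence the generalization over `F`.
  induction n generalizing F with
  | zero =>
    exact contDiff_zero.2 (ContinuousMap.continuous_postcomp _)
  | succ n ih =>
    have hf' := (contDiff_infty_iff_fderiv.1 hf).2
    refine contDiff_succ_iff_hasFDerivAt.2 ⟨_, ?_, ContinuousMap.hasFDerivAt_postcomp
      (hf.of_le (by simp))⟩
    exact (ContinuousMap.pointwiseApply K E F).contDiff.comp (ih hf')

end Postcomposition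

/-! ### Smooth local flows in Banach spaces -/

section LocalFlow

variable {E : Type} [NormedAddCommGroup E] [NormedSpace ℝ E] [CompleteSpace E]

/-- The operator `α ↦ (t ↦ ∫₀ᵗ α)` on continuous curves `[0, 1] → E`. -/
def primitiveCLM (E : Type) [NormedAddCommGroup E] [NormedSpace ℝ E] [CompleteSpace E] :
    C(Icc (0 : ℝ) 1, E) →L[ℝ] C(Icc (0 : ℝ) 1, E) :=
  LinearMap.mkContinuous
    { toFun := fun α => ⟨fun t => ∫ u in (0 : ℝ)..t, IccExtend zero_le_one α u,
        (intervalIntegral.continuous_primitive (fun _ _ =>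
          (α.continuous.Icc_extend' (h := zero_le_one)).intervalIntegrable _ _) 0).comp continuous_subtype_val⟩
      map_add' := fun α β => by
        ext t
        exact intervalIntegral.integral_add
          ((α.continuous.Icc_extend' (h := zero_le_one)).intervalIntegrable _ _)
          ((β.continuous.Icc_extend' (h := zero_le_one)).intervalIntegrable _ _)
      map_smul' := fun c α => by
        ext t
        exact intervalIntegral.integral_smul c (IccExtend zero_le_one α) } 1
    (fun α => by
      rw [ContinuousMap.norm_le _ (by positivity)]
      intro t
      have h := intervalIntegral.norm_integral_le_of_norm_le_const (a := 0) (b := (t : ℝ))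
        (C := ‖α‖) (f := IccExtend zero_le_one α) (fun u _ => α.norm_coe_le_norm _)
      refine h.trans ?_
      rw [one_mul, sub_zero, abs_of_nonneg t.2.1]
      exact mul_le_of_le_one_right (norm_nonneg _) t.2.2)

theorem primitiveCLM_apply (α : C(Icc (0 : ℝ) 1, E)) (t : Icc (0 : ℝ) 1) :
    primitiveCLM E α t = ∫ u in (0 : ℝ)..t, IccExtend zero_le_one α u := rfl

/-- Rescaling `τ ↦ α (σ τ)` of a curve on `[0, 1]`, for `σ ∈ [0, 1]`. -/
def unitRescale (σ : Icc (0 : ℝ) 1) (α : C(Icc (0 : ℝ) 1, E)) : C(Icc (0 : ℝ) 1, E) :=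
  α.comp ⟨fun τ => σ * τ, by fun_prop⟩

/-- Substitution in the integral. It turns a solution of α' = t f(α) into a solution of α' = σt
f(α). -/
theorem primitiveCLM_unitRescale (σ τ : Icc (0 : ℝ) 1) (α : C(Icc (0 : ℝ) 1, E)) :
    (σ : ℝ) • primitiveCLM E (unitRescale σ α) τ = primitiveCLM E α (σ * τ) := by
  rw [primitiveCLM_apply, primitiveCLM_apply]
  have h : ∫ u in (0 : ℝ)..τ, IccExtend zero_le_one (unitRescale σ α) u =
      ∫ u in (0 : ℝ)..τ, IccExtend zero_le_one α ((σ : ℝ) * u) := by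
    refine intervalIntegral.integral_congr fun u hu => ?_
    rw [uIcc_of_le τ.2.1] at hu
    have hu' : u ∈ Icc (0 : ℝ) 1 := ⟨hu.1, hu.2.trans τ.2.2⟩
    have h1 : (σ : ℝ) * u ∈ Icc (0 : ℝ) 1 := (σ * ⟨u, hu'⟩ : Icc (0 : ℝ) 1).2
    rw [IccExtend_of_mem _ _ hu', IccExtend_of_mem _ _ h1]
    rfl
  rw [h, intervalIntegral.smul_integral_comp_mul_left, mul_zero]
  rfl

/-- The map whose local inverse gives the solutions of `α' = l f(α)`, `α(0) = x` on `[0, 1]`. -/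
def picardMap (f : C(E, E)) (p : ℝ × E × C(Icc (0 : ℝ) 1, E)) : ℝ × E × C(Icc (0 : ℝ) 1, E) :=
  (p.1, p.2.1, p.2.2 - ContinuousMap.const _ p.2.1 - p.1 • primitiveCLM E (f.comp p.2.2))

/-- Constant curves. -/
def constCLM (E : Type) [NormedAddCommGroup E] [NormedSpace ℝ E] : E →L[ℝ] C(Icc (0 : ℝ) 1, E) :=
  LinearMap.mkContinuous
    { toFun := fun x => ContinuousMap.const _ x
      map_add' := fun _ _ => rfl
      map_smul' := fun _ _ => rfl } 1
    (fun x => by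
      rw [one_mul]
      exact (ContinuousMap.norm_le _ (norm_nonneg x)).2 fun _ => le_rfl)

theorem contDiff_picardMap {f : E → E} (hf : ContDiff ℝ ∞ f) :
    ContDiff ℝ ∞ (picardMap (⟨f, hf.continuous⟩ : C(E, E))) := by
  refine contDiff_fst.prodMk (contDiff_snd.fst.prodMk ?_)
  refine (contDiff_snd.snd.sub ((constCLM E).contDiff.comp contDiff_snd.fst)).sub ?_
  exact contDiff_fst.smul ((primitiveCLM E).contDiff.comp
    ((ContinuousMap.contDiff_postcomp hf).comp contDiff_snd.snd))

/-- The derivative of `picardMap` at a point with first coordinate `0`. -/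
def picardDeriv (v : C(Icc (0 : ℝ) 1, E)) :
    (ℝ × E × C(Icc (0 : ℝ) 1, E)) ≃L[ℝ] (ℝ × E × C(Icc (0 : ℝ) 1, E)) :=
  ContinuousLinearEquiv.equivOfInverse
    ((ContinuousLinearMap.fst ℝ _ _).prod
      ((ContinuousLinearMap.fst ℝ _ _ ∘L ContinuousLinearMap.snd ℝ _ _).prod
        (ContinuousLinearMap.snd ℝ _ _ ∘L ContinuousLinearMap.snd ℝ _ _
          - constCLM E ∘L ContinuousLinearMap.fst ℝ _ _ ∘L ContinuousLinearMap.snd ℝ _ _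
          - (ContinuousLinearMap.fst ℝ _ _).smulRight v)))
    ((ContinuousLinearMap.fst ℝ _ _).prod
      ((ContinuousLinearMap.fst ℝ _ _ ∘L ContinuousLinearMap.snd ℝ _ _).prod
        (ContinuousLinearMap.snd ℝ _ _ ∘L ContinuousLinearMap.snd ℝ _ _
          + constCLM E ∘L ContinuousLinearMap.fst ℝ _ _ ∘L ContinuousLinearMap.snd ℝ _ _
          + (ContinuousLinearMap.fst ℝ _ _).smulRight v)))
    (fun p => Prod.ext rfl (Prod.ext rfl (by
      simp only [ContinuousLinearMap.prod_apply, _root_.sub_apply,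
        _root_.add_apply, ContinuousLinearMap.comp_apply,
        ContinuousLinearMap.smulRight_apply, ContinuousLinearMap.coe_fst',
        ContinuousLinearMap.coe_snd']
      abel)))
    (fun p => Prod.ext rfl (Prod.ext rfl (by
      simp only [ContinuousLinearMap.prod_apply, _root_.sub_apply,
        _root_.add_apply, ContinuousLinearMap.comp_apply,
        ContinuousLinearMap.smulRight_apply, ContinuousLinearMap.coe_fst',
        ContinuousLinearMap.coe_snd']
      abel)))

/-- At parameter l = 0 the term l ∫ f(α) contributes only dl ∫ f(α). The derivative is therefore
triangular and explicitly invertible, without any smallness assumption. -/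
theorem hasFDerivAt_picardMap {f : E → E} (hf : ContDiff ℝ ∞ f) (x : E) (α : C(Icc (0 : ℝ) 1, E)) :
    HasFDerivAt (picardMap (⟨f, hf.continuous⟩ : C(E, E)))
      (picardDeriv (primitiveCLM E ((⟨f, hf.continuous⟩ : C(E, E)).comp α)) :
        (ℝ × E × C(Icc (0 : ℝ) 1, E)) →L[ℝ] (ℝ × E × C(Icc (0 : ℝ) 1, E))) (0, x, α) := by
  have h1 : HasFDerivAt (fun p : ℝ × E × C(Icc (0 : ℝ) 1, E) =>
      primitiveCLM E ((⟨f, hf.continuous⟩ : C(E, E)).comp p.2.2)) _ (0, x, α) :=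
    (((primitiveCLM E).contDiff.comp ((ContinuousMap.contDiff_postcomp hf).comp
      contDiff_snd.snd)).differentiable (by simp) (0, x, α)).hasFDerivAt
  have h2 := (hasFDerivAt_fst (𝕜 := ℝ) (p := ((0 : ℝ), x, α))).smul h1
  have h3 := ((ContinuousLinearMap.snd ℝ E C(Icc (0 : ℝ) 1, E) ∘L
    ContinuousLinearMap.snd ℝ ℝ (E × C(Icc (0 : ℝ) 1, E))
    - constCLM E ∘L ContinuousLinearMap.fst ℝ _ _ ∘L ContinuousLinearMap.snd ℝ _ _).hasFDerivAt
      (x := ((0 : ℝ), x, α))).sub h2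
  have h4 := (hasFDerivAt_fst (𝕜 := ℝ) (p := ((0 : ℝ), x, α))).prodMk
    (((ContinuousLinearMap.fst ℝ E C(Icc (0 : ℝ) 1, E) ∘L
      ContinuousLinearMap.snd ℝ ℝ (E × C(Icc (0 : ℝ) 1, E))).hasFDerivAt
        (x := ((0 : ℝ), x, α))).prodMk h3)
  refine h4.congr_fderiv ?_
  ext <;> simp [picardDeriv]

/-- Time is treated as a parameter: the flow at time t is α(1), where α' = t f(α) on [0, 1] and α(0)
= x. The inverse function theorem for `picardMap` at (0, q, const q) makes α smooth in (t, x)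
jointly. -/
theorem exists_flow_of_contDiff {f : E → E} (hf : ContDiff ℝ ∞ f) (q : E) :
    ∃ (Φ : ℝ × E → E) (δ : ℝ), 0 < δ ∧ ContDiffOn ℝ ∞ Φ (Ioo (-δ) δ ×ˢ Metric.ball q δ) ∧
      ∀ x ∈ Metric.ball q δ, Φ (0, x) = x ∧
        ∀ t ∈ Ioo (-δ) δ, HasDerivAt (fun t' => Φ (t', x)) (f (Φ (t, x))) t := by
  set P := picardMap (⟨f, hf.continuous⟩ : C(E, E)) with hP
  have hPs : ContDiff ℝ ∞ P := contDiff_picardMap hf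
  set p₀ : ℝ × E × C(Icc (0 : ℝ) 1, E) := (0, q, ContinuousMap.const _ q) with hp₀
  have hd := hasFDerivAt_picardMap hf q (ContinuousMap.const _ q)
  have hP0 : P p₀ = (0, q, 0) := by simp [hP, picardMap, hp₀]
  set e := hPs.contDiffAt.toOpenPartialHomeomorph P hd (by simp) with he
  have hsrc : p₀ ∈ e.source := hPs.contDiffAt.mem_toOpenPartialHomeomorph_source hd (by simp)
  -- Invertibility of the derivative on a whole neighbourhood is what makes `e.symm` smooth at all
  -- nearby points, not just at the image of `p₀`.
  have hW : ∀ᶠ p in 𝓝 p₀, ∃ A : (ℝ × E × C(Icc (0 : ℝ) 1, E)) ≃L[ℝ] (ℝ × E × C(Icc (0 : ℝ) 1, E)),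
      HasFDerivAt P (A : _ →L[ℝ] _) p := by
    have h1 := (hPs.continuous_fderiv (by simp)).continuousAt (x := p₀)
    have h2 := ContinuousLinearEquiv.nhds
      (picardDeriv (primitiveCLM E ((⟨f, hf.continuous⟩ : C(E, E)).comp (ContinuousMap.const _ q))))
    rw [← hd.fderiv] at h2
    filter_upwards [h1 h2] with p hp
    obtain ⟨A, hA⟩ := hp
    exact ⟨A, by rw [hA]; exact (hPs.differentiable (by simp) p).hasFDerivAt⟩
  obtain ⟨ρ, hρ, hball⟩ := Metric.eventually_nhds_iff_ball.1
    (hW.and (e.open_source.mem_nhds hsrc))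
  have hcs : ContinuousAt e.symm (0, q, 0) := by
    have := e.continuousAt_symm (e.map_source hsrc)
    rwa [show e p₀ = (0, q, 0) from hP0] at this
  have hts : ((0 : ℝ), q, (0 : C(Icc (0 : ℝ) 1, E))) ∈ e.target := by
    have := e.map_source hsrc
    rwa [show e p₀ = (0, q, 0) from hP0] at this
  have hsp : e.symm (0, q, 0) = p₀ := by
    have := e.left_inv hsrc
    rwa [show e p₀ = (0, q, 0) from hP0] at this
  have hcz : ContinuousAt (fun z : ℝ × E => (z.1, z.2, (0 : C(Icc (0 : ℝ) 1, E)))) (0, q) := by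
    fun_prop
  have hn : ∀ᶠ z : ℝ × E in 𝓝 (0, q), (z.1, z.2, (0 : C(Icc (0 : ℝ) 1, E))) ∈ e.target ∧
      e.symm (z.1, z.2, 0) ∈ Metric.ball p₀ ρ :=
    (hcz.eventually (e.open_target.mem_nhds hts)).and (hcz.eventually (hcs.eventually
      (by rw [hsp]; exact Metric.ball_mem_nhds _ hρ)))
  obtain ⟨δ, hδ, hδb⟩ := Metric.eventually_nhds_iff_ball.1 hn
  have key : ∀ t ∈ Ioo (-δ) δ, ∀ x ∈ Metric.ball q δ,
      (t, x, (0 : C(Icc (0 : ℝ) 1, E))) ∈ e.target ∧ e.symm (t, x, 0) ∈ Metric.ball p₀ ρ := by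
    intro t ht x hx
    refine hδb (t, x) ?_
    rw [← ball_prod_same]
    exact ⟨by rw [Real.ball_eq_Ioo]; simpa using ht, hx⟩
  set α : ℝ → E → C(Icc (0 : ℝ) 1, E) := fun t x => (e.symm (t, x, 0)).2.2 with hα
  have hsymm : ∀ t ∈ Ioo (-δ) δ, ∀ x ∈ Metric.ball q δ, e.symm (t, x, 0) = (t, x, α t x) ∧
      α t x = ContinuousMap.const _ x +
        t • primitiveCLM E ((⟨f, hf.continuous⟩ : C(E, E)).comp (α t x)) := by
    intro t ht x hx
    have h1 : P (e.symm (t, x, 0)) = (t, x, 0) := e.right_inv (key t ht x hx).1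
    have h2 : (e.symm (t, x, 0)).1 = t := congrArg Prod.fst h1
    have h3 : (e.symm (t, x, 0)).2.1 = x := congrArg (fun p => p.2.1) h1
    have h4 := congrArg (fun p => p.2.2) h1
    refine ⟨Prod.ext h2 (Prod.ext h3 rfl), ?_⟩
    simp only [hP, picardMap, h2, h3] at h4
    rw [sub_sub, sub_eq_zero] at h4
    exact h4
  -- The rescaled curve and the solution with parameter σt have the same image under `P`. Rescaling
  -- does not increase the distance to a constant curve, so both lie in the ball where `P` is
  -- injective.
  have hscale : ∀ t ∈ Ioo (-δ) δ, ∀ x ∈ Metric.ball q δ, ∀ σ : Icc (0 : ℝ) 1,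
      (σ : ℝ) * t ∈ Ioo (-δ) δ ∧ α t x σ = α (σ * t) x 1 := by
    intro t ht x hx σ
    have hst : (σ : ℝ) * t ∈ Ioo (-δ) δ := by
      rw [mem_Ioo, ← abs_lt] at ht ⊢
      rw [abs_mul, abs_of_nonneg σ.2.1]
      exact (mul_le_of_le_one_left (abs_nonneg t) σ.2.2).trans_lt ht
    refine ⟨hst, ?_⟩
    obtain ⟨h1, h2⟩ := hsymm t ht x hx
    obtain ⟨h3, h4⟩ := hsymm _ hst x hx
    have hb1 := (key t ht x hx).2
    have hb2 := (key _ hst x hx).2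
    rw [h1] at hb1
    rw [h3] at hb2
    rw [hp₀, ← ball_prod_same, ← ball_prod_same] at hb1 hb2
    have hb : ((σ : ℝ) * t, x, unitRescale σ (α t x)) ∈ Metric.ball p₀ ρ := by
      rw [hp₀, ← ball_prod_same, ← ball_prod_same]
      refine ⟨hb2.1, hb1.2.1, ?_⟩
      rw [Metric.mem_ball, ContinuousMap.dist_lt_iff hρ]
      intro τ
      exact (ContinuousMap.dist_lt_iff hρ).1 hb1.2.2 (σ * τ)
    have hPeq : P ((σ : ℝ) * t, x, unitRescale σ (α t x)) = ((σ : ℝ) * t, x, 0) := by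
      refine Prod.ext rfl (Prod.ext rfl ?_)
      change unitRescale σ (α t x) - ContinuousMap.const _ x - ((σ : ℝ) * t) • primitiveCLM E
        (unitRescale σ ((⟨f, hf.continuous⟩ : C(E, E)).comp (α t x))) = 0
      rw [sub_sub, sub_eq_zero]
      ext τ
      have h5 := DFunLike.congr_fun h2 (σ * τ)
      rw [ContinuousMap.add_apply, ContinuousMap.smul_apply, mul_comm, mul_smul,
        primitiveCLM_unitRescale]
      exact h5
    have h6 : e.symm ((σ : ℝ) * t, x, 0) = ((σ : ℝ) * t, x, unitRescale σ (α t x)) := by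
      rw [← hPeq]
      exact e.left_inv (hball _ hb).2
    have h7 : α (σ * t) x = unitRescale σ (α t x) := congrArg (fun p => p.2.2) h6
    rw [h7]
    change α t x σ = α t x (σ * 1)
    rw [mul_one]
  set Φ : ℝ × E → E := fun z => α z.1 z.2 1 with hΦ
  have hsmooth : ContDiffOn ℝ ∞ Φ (Ioo (-δ) δ ×ˢ Metric.ball q δ) := by
    rintro ⟨t, x⟩ ⟨ht, hx⟩
    obtain ⟨A, hA⟩ := (hball _ (key t ht x hx).2).1
    have h1 : ContDiffAt ℝ ∞ e.symm (t, x, 0) :=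
      e.contDiffAt_symm (key t ht x hx).1 hA hPs.contDiffAt
    have h2 : ContDiffAt ℝ ∞ (fun z : ℝ × E => (z.1, z.2, (0 : C(Icc (0 : ℝ) 1, E)))) (t, x) := by
      fun_prop
    have h3 := (ContDiffAt.comp (f := fun z : ℝ × E => (z.1, z.2, (0 : C(Icc (0 : ℝ) 1, E))))
      (t, x) h1 h2).snd.snd
    exact ((ContinuousMap.evalCLM ℝ (1 : Icc (0 : ℝ) 1)).contDiff.contDiffAt.comp
      (t, x) h3).contDiffWithinAt
  have hint : ∀ t ∈ Ioo (-δ) δ, ∀ x ∈ Metric.ball q δ,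
      Φ (t, x) = x + ∫ u in (0 : ℝ)..t, f (Φ (u, x)) := by
    intro t ht x hx
    have h2 := DFunLike.congr_fun (hsymm t ht x hx).2 1
    rw [ContinuousMap.add_apply, ContinuousMap.smul_apply, primitiveCLM_apply] at h2
    refine h2.trans ?_
    rw [ContinuousMap.const_apply]
    congr 1
    -- The scaling identity rewrites the integrand as f(Φ(ut, x)); the factor t is then absorbed by
    -- the substitution ut ↦ u, which gives an integral equation in t.
    have h3 : ∫ u in (0 : ℝ)..(1 : Icc (0 : ℝ) 1),
        IccExtend zero_le_one ((⟨f, hf.continuous⟩ : C(E, E)).comp (α t x)) u =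
        ∫ u in (0 : ℝ)..1, f (Φ (u * t, x)) := by
      refine intervalIntegral.integral_congr fun u hu => ?_
      have hu' : u ∈ Icc (0 : ℝ) 1 := by
        rwa [show ((1 : Icc (0 : ℝ) 1) : ℝ) = 1 from rfl, uIcc_of_le zero_le_one] at hu
      rw [IccExtend_of_mem _ _ hu']
      exact congrArg f (hscale t ht x hx ⟨u, hu'⟩).2
    rw [h3]
    have h4 := intervalIntegral.smul_integral_comp_mul_right (a := 0) (b := 1)
      (fun u => f (Φ (u, x))) t
    rwa [zero_mul, one_mul] at h4
  refine ⟨Φ, δ, hδ, hsmooth, fun x hx => ⟨?_, fun t ht => ?_⟩⟩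
  · rw [hint 0 ⟨by linarith, hδ⟩ x hx, intervalIntegral.integral_same, add_zero]
  · have hc : ContinuousOn (fun u => f (Φ (u, x))) (Ioo (-δ) δ) :=
      hf.continuous.comp_continuousOn (hsmooth.continuousOn.comp (by fun_prop)
        fun u hu => ⟨hu, hx⟩)
    have hsub : uIcc 0 t ⊆ Ioo (-δ) δ :=
      (ordConnected_Ioo.uIcc_subset ⟨by linarith, hδ⟩ ht)
    have h1 := intervalIntegral.integral_hasDerivAt_right
      (hc.mono hsub).intervalIntegrable
      (hc.stronglyMeasurableAtFilter isOpen_Ioo t ht) (hc.continuousAt (isOpen_Ioo.mem_nhds ht))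
    refine (h1.const_add x).congr_of_eventuallyEq ?_
    filter_upwards [isOpen_Ioo.mem_nhds ht] with t' ht' using hint t' ht' x hx

end LocalFlow

/-! ### Flows of vector fields on open subsets of a finite-dimensional space -/

section FiniteDimensional

variable {E : Type} [NormedAddCommGroup E] [NormedSpace ℝ E] [FiniteDimensional ℝ E]

/-- A smooth vector field on an open set has a smooth local flow. -/
theorem exists_flow_of_contDiffOn {f : E → E} {s : Set E} (hs : IsOpen s) (hf : ContDiffOn ℝ ∞ f s)
    {q : E} (hq : q ∈ s) :
    ∃ (Φ : ℝ × E → E) (δ : ℝ), 0 < δ ∧ ContDiffOn ℝ ∞ Φ (Ioo (-δ) δ ×ˢ Metric.ball q δ) ∧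
      ∀ x ∈ Metric.ball q δ, Φ (0, x) = x ∧ ∀ t ∈ Ioo (-δ) δ, Φ (t, x) ∈ s ∧
        HasDerivAt (fun t' => Φ (t', x)) (f (Φ (t, x))) t := by
  have : CompleteSpace E := FiniteDimensional.complete ℝ E
  obtain ⟨R, hR, hRs⟩ := Metric.isOpen_iff.1 hs q hq
  -- The cut-off field is smooth on the whole space and agrees with `f` on the ball of radius R/4.
  -- Shrinking δ keeps the flow in that ball.
  let b : ContDiffBump q := ⟨R / 4, R / 2, by linarith, by linarith⟩
  have hg : ContDiff ℝ ∞ (fun x => b x • f x) := by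
    rw [contDiff_iff_contDiffAt]
    intro x
    by_cases hx : x ∈ s
    · exact b.contDiff.contDiffAt.smul (hf.contDiffAt (hs.mem_nhds hx))
    · have hx' : x ∉ tsupport b := by
        rw [b.tsupport_eq]
        intro h
        exact hx (hRs (Metric.closedBall_subset_ball (by change R / 2 < R; linarith) h))
      refine contDiffAt_const (c := (0 : E)) |>.congr_of_eventuallyEq ?_
      filter_upwards [notMem_tsupport_iff_eventuallyEq.1 hx'] with y hy
      rw [hy]
      simp
  obtain ⟨Φ, δ, hδ, h1, h2⟩ := exists_flow_of_contDiff hg q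
  have hc : ContinuousAt Φ (0, q) := (h1.continuousOn).continuousAt
    (prod_mem_nhds (Ioo_mem_nhds (by linarith) hδ) (Metric.ball_mem_nhds q hδ))
  have hΦq : Φ (0, q) = q := (h2 q (Metric.mem_ball_self hδ)).1
  have hev : ∀ᶠ z in 𝓝 ((0 : ℝ), q), Φ z ∈ Metric.ball q (R / 4) :=
    hc (by rw [hΦq]; exact Metric.ball_mem_nhds _ (by linarith))
  obtain ⟨η, hη, hηb⟩ := Metric.eventually_nhds_iff_ball.1 hev
  have hI : Ioo (-min δ η) (min δ η) ⊆ Ioo (-δ) δ :=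
    Ioo_subset_Ioo (neg_le_neg (min_le_left _ _)) (min_le_left _ _)
  have hB : Metric.ball q (min δ η) ⊆ Metric.ball q δ := Metric.ball_subset_ball (min_le_left _ _)
  refine ⟨Φ, min δ η, lt_min hδ hη, h1.mono (prod_mono hI hB), fun x hx =>
    ⟨(h2 x (hB hx)).1, fun t ht => ?_⟩⟩
  have hm : Φ (t, x) ∈ Metric.ball q (R / 4) := by
    refine hηb (t, x) ?_
    rw [← ball_prod_same]
    refine ⟨?_, Metric.ball_subset_ball (min_le_right _ _) hx⟩
    rw [Real.ball_eq_Ioo, zero_sub, zero_add]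
    exact Ioo_subset_Ioo (neg_le_neg (min_le_right _ _)) (min_le_right _ _) ht
  refine ⟨hRs (Metric.ball_subset_ball (by linarith) hm), ?_⟩
  have h3 := (h2 x (hB hx)).2 t (hI ht)
  rwa [b.one_of_mem_closedBall (Metric.ball_subset_closedBall hm), one_smul] at h3

end FiniteDimensional

/-! ### Integral curves and smooth families of them on manifolds -/

section IntegralCurves

variable {E H : Type} {M : Type u} [NormedAddCommGroup E] [NormedSpace ℝ E] [TopologicalSpace H]
  {I : ModelWithCorners ℝ E H} [TopologicalSpace M] [ChartedSpace H M]

/-- A vector field in coordinates, read in the preferred chart at `q`. -/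
def coordField (I : ModelWithCorners ℝ E H) (F : M → TangentBundle I M) [IsManifold I ∞ M] (q : M)
    (y : E) : E :=
  -- The chart of the tangent bundle depends only on the base point, so the zero vector here is an
  -- arbitrary choice.
  (extChartAt I.tangent (⟨q, 0⟩ : TangentBundle I M) (F ((extChartAt I q).symm y))).2

theorem isOpen_extChartAt_symm_preimage [I.Boundaryless] {Ω : Set M} (hΩ : IsOpen Ω) (q : M) :
    IsOpen ((extChartAt I q).target ∩ (extChartAt I q).symm ⁻¹' Ω) :=
  (continuousOn_extChartAt_symm q).isOpen_inter_preimage (isOpen_extChartAt_target q) hΩ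

variable [IsManifold I ∞ M]

/-- Points over different base points are separated by the projection; points over the same one lie
in a common trivialization. Uniqueness of integral curves in iterated tangent bundles needs this. -/
theorem t2Space_tangentBundle [T2Space M] : T2Space (TangentBundle I M) := by
  refine ⟨fun p q hpq => ?_⟩
  by_cases h : p.1 = q.1
  · set e := trivializationAt E (TangentSpace I) p.1
    have hp : p ∈ e.source := by
      rw [e.mem_source]; exact mem_baseSet_trivializationAt E (TangentSpace I) p.1
    have hq : q ∈ e.source := by
      rw [e.mem_source, ← h]; exact mem_baseSet_trivializationAt E (TangentSpace I) p.1
    have hne : e p ≠ e q := fun h' => hpq (e.injOn hp hq h')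
    obtain ⟨u, v, hu, hv, hpu, hqv, huv⟩ := t2_separation hne
    refine ⟨e.source ∩ e ⁻¹' u, e.source ∩ e ⁻¹' v,
      e.continuousOn.isOpen_inter_preimage e.open_source hu,
      e.continuousOn.isOpen_inter_preimage e.open_source hv, ⟨hp, hpu⟩, ⟨hq, hqv⟩, ?_⟩
    exact (huv.preimage e).mono inter_subset_right inter_subset_right
  · exact separated_by_continuous (FiberBundle.continuous_proj E (TangentSpace I)) h

theorem contDiffOn_coordField {F : M → TangentBundle I M} {Ω : Set M}
    (hF : ContMDiffOn I I.tangent ∞ F Ω) (hF1 : ∀ x ∈ Ω, (F x).1 = x) (q : M) :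
    ContDiffOn ℝ ∞ (coordField I F q)
      ((extChartAt I q).target ∩ (extChartAt I q).symm ⁻¹' Ω) := by
  have h1 : ContMDiffOn 𝓘(ℝ, E) I ∞ (extChartAt I q).symm
      ((extChartAt I q).target ∩ (extChartAt I q).symm ⁻¹' Ω) :=
    (contMDiffOn_extChartAt_symm q).mono inter_subset_left
  have h2 := hF.comp h1 fun y hy => hy.2
  have h3 := (contMDiffOn_extChartAt (I := I.tangent) (n := ∞)
    (x := (⟨q, 0⟩ : TangentBundle I M))).comp h2 (fun y hy => by
      rw [mem_preimage, TangentBundle.mem_chart_source_iff, Function.comp_apply, hF1 _ hy.2]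
      have := (extChartAt I q).map_target hy.1
      rwa [extChartAt_source] at this)
  exact (contMDiffOn_iff_contDiffOn.1 h3).snd

/-- Since `F` is a section at `c t`, the base components agree automatically, and only the fibre
coordinates have to be compared. -/
theorem velocity_eq_iff_deriv {F : M → TangentBundle I M} {c : ℝ → M} {t : ℝ} {q : M}
    (hF1 : (F (c t)).1 = c t) (hc : MDifferentiableAt 𝓘(ℝ, ℝ) I c t)
    (hq : c t ∈ (extChartAt I q).source) :
    velocity I c t = F (c t) ↔
      deriv (extChartAt I q ∘ c) t = coordField I F q (extChartAt I q (c t)) := by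
  have hs : c t ∈ (chartAt H q).source := by rwa [extChartAt_source] at hq
  have h1 := extChartAt_velocity hc (⟨q, 0⟩ : TangentBundle I M) hs
  have h2 : coordField I F q (extChartAt I q (c t)) =
      (extChartAt I.tangent (⟨q, 0⟩ : TangentBundle I M) (F (c t))).2 := by
    rw [coordField, (extChartAt I q).left_inv hq]
  have m1 : velocity I c t ∈ (extChartAt I.tangent (⟨q, 0⟩ : TangentBundle I M)).source := by
    rw [extChartAt_source, TangentBundle.mem_chart_source_iff]; exact hs
  have m2 : F (c t) ∈ (extChartAt I.tangent (⟨q, 0⟩ : TangentBundle I M)).source := by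
    rw [extChartAt_source, TangentBundle.mem_chart_source_iff, hF1]; exact hs
  have h3 : (extChartAt I.tangent (⟨q, 0⟩ : TangentBundle I M) (F (c t))).1 =
      extChartAt I q (c t) := congrArg (extChartAt I q) hF1
  rw [h2]
  constructor
  · intro h
    rw [← h, h1]
  · intro h
    refine (extChartAt I.tangent (⟨q, 0⟩ : TangentBundle I M)).injOn m1 m2 ?_
    rw [h1]
    exact Prod.ext h3.symm h

variable [I.Boundaryless] [FiniteDimensional ℝ E]

/-- A smooth vector field, defined on an open set, has a smooth local flow. -/
theorem exists_local_flow {F : M → TangentBundle I M} {Ω : Set M}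
    (hΩ : IsOpen Ω)
    (hF : ContMDiffOn I I.tangent ∞ F Ω) (hF1 : ∀ x ∈ Ω, (F x).1 = x) {q : M} (hq : q ∈ Ω) :
    ∃ (Φ : ℝ × M → M) (δ : ℝ) (U : Set M), 0 < δ ∧ IsOpen U ∧ q ∈ U ∧
      ContMDiffOn (𝓘(ℝ, ℝ).prod I) I ∞ Φ (Ioo (-δ) δ ×ˢ U) ∧
      ∀ x ∈ U, Φ (0, x) = x ∧ ∀ t ∈ Ioo (-δ) δ, Φ (t, x) ∈ Ω ∧
        velocity I (fun t' => Φ (t', x)) t = F (Φ (t, x)) := by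
  set φ := extChartAt I q with hφ
  obtain ⟨Ψ, δ, hδ, h1, h2⟩ := exists_flow_of_contDiffOn (isOpen_extChartAt_symm_preimage hΩ q)
    (contDiffOn_coordField hF hF1 q) (q := φ q)
    ⟨mem_extChartAt_target q, by rw [mem_preimage, extChartAt_to_inv]; exact hq⟩
  have hUo : IsOpen (φ.source ∩ φ ⁻¹' Metric.ball (φ q) δ) :=
    (continuousOn_extChartAt q).isOpen_inter_preimage (isOpen_extChartAt_source q)
      Metric.isOpen_ball
  have hsm : ContMDiffOn (𝓘(ℝ, ℝ).prod I) I ∞ (fun z : ℝ × M => φ.symm (Ψ (z.1, φ z.2)))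
      (Ioo (-δ) δ ×ˢ (φ.source ∩ φ ⁻¹' Metric.ball (φ q) δ)) := by
    have a1 : ContMDiffOn (𝓘(ℝ, ℝ).prod I) 𝓘(ℝ, E) ∞ (fun z : ℝ × M => φ z.2)
        (Ioo (-δ) δ ×ˢ (φ.source ∩ φ ⁻¹' Metric.ball (φ q) δ)) :=
      (contMDiffOn_extChartAt (I := I) (n := ∞) (x := q)).comp contMDiff_snd.contMDiffOn
        (fun z hz => by have := hz.2.1; rwa [hφ, extChartAt_source] at this)
    have a2 : ContMDiffOn (𝓘(ℝ, ℝ).prod I) 𝓘(ℝ, ℝ × E) ∞ (fun z : ℝ × M => (z.1, φ z.2))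
        (Ioo (-δ) δ ×ˢ (φ.source ∩ φ ⁻¹' Metric.ball (φ q) δ)) :=
      contMDiff_fst.contMDiffOn.prodMk_space a1
    have a3 := h1.contMDiffOn.comp a2 (fun z hz => ⟨hz.1, hz.2.2⟩)
    exact (contMDiffOn_extChartAt_symm q).comp a3 (fun z hz =>
      ((h2 _ hz.2.2).2 z.1 hz.1).1.1)
  refine ⟨fun z => φ.symm (Ψ (z.1, φ z.2)), δ, φ.source ∩ φ ⁻¹' Metric.ball (φ q) δ, hδ, hUo,
    ⟨mem_extChartAt_source q, Metric.mem_ball_self hδ⟩, hsm, fun x hx => ⟨?_, fun t ht => ?_⟩⟩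
  · dsimp only
    rw [(h2 _ hx.2).1, φ.left_inv hx.1]
  · obtain ⟨b1, b2⟩ := (h2 _ hx.2).2 t ht
    refine ⟨b1.2, ?_⟩
    have hmd : MDifferentiableAt 𝓘(ℝ, ℝ) I (fun t' => φ.symm (Ψ (t', φ x))) t := by
      have hat := hsm.contMDiffAt (prod_mem_nhds (Ioo_mem_nhds ht.1 ht.2) (hUo.mem_nhds hx))
        (x := (t, x))
      have := ContMDiffAt.comp (f := fun t' : ℝ => (t', x)) t hat
        (contMDiffAt_id.prodMk contMDiffAt_const)
      exact this.mdifferentiableAt (by simp)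
    refine (velocity_eq_iff_deriv (q := q) (hF1 _ b1.2) hmd (φ.map_target b1.1)).2 ?_
    rw [← hφ, φ.right_inv b1.1]
    refine (b2.congr_of_eventuallyEq ?_).deriv
    filter_upwards [Ioo_mem_nhds ht.1 ht.2] with t' ht'
    exact φ.right_inv ((h2 _ hx.2).2 t' ht').1.1

/-- Uniqueness of integral curves on intervals. -/
theorem eqOn_of_velocity_eq [T2Space M] {F : M → TangentBundle I M}
    {Ω : Set M} (hΩ : IsOpen Ω)
    (hF : ContMDiffOn I I.tangent ∞ F Ω) (hF1 : ∀ x ∈ Ω, (F x).1 = x) {O : Set ℝ} (hO : IsOpen O)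
    (hOc : IsPreconnected O) {c₁ c₂ : ℝ → M}
    (hc₁ : ∀ t ∈ O, MDifferentiableAt 𝓘(ℝ, ℝ) I c₁ t) (hc₂ : ∀ t ∈ O, MDifferentiableAt 𝓘(ℝ, ℝ) I c₂ t)
    (hm₁ : ∀ t ∈ O, c₁ t ∈ Ω)
    (hv₁ : ∀ t ∈ O, velocity I c₁ t = F (c₁ t)) (hv₂ : ∀ t ∈ O, velocity I c₂ t = F (c₂ t))
    {t₀ : ℝ} (ht₀ : t₀ ∈ O) (h₀ : c₁ t₀ = c₂ t₀) : EqOn c₁ c₂ O := by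
  have : CompleteSpace E := FiniteDimensional.complete ℝ E
  have : BoundarylessManifold I M := inferInstance
  have : IsManifold I 1 M := IsManifold.of_le (n := ∞) (by simp)
  let v : (x : M) → TangentSpace I x := fun x => (show E from (F x).2)
  have hint : ∀ c : ℝ → M, (∀ t ∈ O, MDifferentiableAt 𝓘(ℝ, ℝ) I c t) →
      (∀ t ∈ O, velocity I c t = F (c t)) → ∀ t ∈ O, IsMIntegralCurveAt c v t := by
    intro c hc hv t ht
    filter_upwards [hO.mem_nhds ht] with t' ht'
    refine (hc t' ht').hasMFDerivAt.congr_mfderiv ?_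
    ext
    have h1 := congrArg (fun ξ : TangentBundle I M => (show E from ξ.2)) (hv t' ht')
    refine h1.trans ?_
    exact (one_smul ℝ (show E from (F (c t')).2)).symm
  -- The coincidence set is open by local uniqueness and closed in `O` by the Hausdorff property.
  have hsub : O ⊆ {t | t ∈ O ∧ c₁ t = c₂ t} := by
    refine hOc.subset_of_closure_inter_subset ?_ ⟨t₀, ht₀, ht₀, h₀⟩ ?_
    · rw [isOpen_iff_mem_nhds]
      rintro t ⟨ht, he⟩
      have hs : ContMDiffAt I I.tangent 1 (fun x => (⟨x, v x⟩ : TangentBundle I M)) (c₁ t) := by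
        refine ((hF.contMDiffAt (hΩ.mem_nhds (hm₁ t ht))).of_le (by simp)).congr_of_eventuallyEq ?_
        filter_upwards [hΩ.mem_nhds (hm₁ t ht)] with x hx
        exact Bundle.TotalSpace.ext (hF1 x hx).symm HEq.rfl
      exact Filter.Eventually.and (hO.mem_nhds ht)
        (isMIntegralCurveAt_eventuallyEq_of_contMDiffAt_boundaryless hs
          (hint c₁ hc₁ hv₁ t ht) (hint c₂ hc₂ hv₂ t ht) he)
    · rintro t ⟨htc, ht⟩
      refine ⟨ht, ?_⟩
      by_contra hne
      have hcont : ContinuousAt (fun t' => (c₁ t', c₂ t')) t :=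
        (hc₁ t ht).continuousAt.prodMk (hc₂ t ht).continuousAt
      have hev : ∀ᶠ t' in 𝓝 t, c₁ t' ≠ c₂ t' :=
        hcont.eventually (isClosed_diagonal.isOpen_compl.mem_nhds hne)
      obtain ⟨t', ht', h'⟩ := mem_closure_iff_nhds.1 htc _ hev
      exact ht' h'.2
  exact fun t ht => (hsub ht).2

/-- A smooth family `c(t, s)`, `t ∈ O`, `|s| < ε`, of integral curves of `F` in `Ω`. -/
structure IsIntegralFamily (I : ModelWithCorners ℝ E H) (F : M → TangentBundle I M) (Ω : Set M)
    (O : Set ℝ) (ε : ℝ) (c : ℝ × ℝ → M) : Prop where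
  smooth : ContMDiffOn 𝓘(ℝ, ℝ × ℝ) I ∞ c (O ×ˢ Ioo (-ε) ε)
  mem : ∀ t ∈ O, ∀ s ∈ Ioo (-ε) ε, c (t, s) ∈ Ω
  velocity_eq : ∀ t ∈ O, ∀ s ∈ Ioo (-ε) ε, velocity I (fun t' => c (t', s)) t = F (c (t, s))

omit [IsManifold I ∞ M] [I.Boundaryless] [FiniteDimensional ℝ E] in
theorem ContMDiffOn.slice_fst {c : ℝ × ℝ → M} {O S : Set ℝ}
    (hc : ContMDiffOn 𝓘(ℝ, ℝ × ℝ) I ∞ c (O ×ˢ S)) {s : ℝ} (hs : s ∈ S) :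
    ContMDiffOn 𝓘(ℝ, ℝ) I ∞ (fun t => c (t, s)) O :=
  hc.comp (f := fun t : ℝ => (t, s)) (ContDiff.contMDiff (by fun_prop)).contMDiffOn
    fun _ ht => ⟨ht, hs⟩

omit [IsManifold I ∞ M] [I.Boundaryless] [FiniteDimensional ℝ E] in
theorem ContMDiffOn.slice_snd {c : ℝ × ℝ → M} {O S : Set ℝ}
    (hc : ContMDiffOn 𝓘(ℝ, ℝ × ℝ) I ∞ c (O ×ˢ S)) {t : ℝ} (ht : t ∈ O) :
    ContMDiffOn 𝓘(ℝ, ℝ) I ∞ (fun s => c (t, s)) S :=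
  hc.comp (f := fun s : ℝ => (t, s)) (ContDiff.contMDiff (by fun_prop)).contMDiffOn
    fun _ hs => ⟨ht, hs⟩

omit [IsManifold I ∞ M] [I.Boundaryless] [FiniteDimensional ℝ E] in
theorem velocity_congr {c c' : ℝ → M} {t : ℝ} (h : c =ᶠ[𝓝 t] c') :
    velocity I c t = velocity I c' t := by
  unfold velocity
  rw [h.mfderiv_eq]
  exact Bundle.TotalSpace.ext h.self_of_nhds HEq.rfl

namespace IsIntegralFamily

variable {F : M → TangentBundle I M} {Ω : Set M} {O O₁ O₂ : Set ℝ} {ε ε' : ℝ} {c c₁ c₂ : ℝ × ℝ → M}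

omit [IsManifold I ∞ M] [I.Boundaryless] [FiniteDimensional ℝ E] in
theorem mono (h : IsIntegralFamily I F Ω O ε c) (hO : O₁ ⊆ O) (hε : ε' ≤ ε) :
    IsIntegralFamily I F Ω O₁ ε' c := by
  have hI : Ioo (-ε') ε' ⊆ Ioo (-ε) ε := Ioo_subset_Ioo (neg_le_neg hε) hε
  exact ⟨h.smooth.mono (prod_mono hO hI), fun t ht s hs => h.mem t (hO ht) s (hI hs),
    fun t ht s hs => h.velocity_eq t (hO ht) s (hI hs)⟩

omit [IsManifold I ∞ M] [I.Boundaryless] [FiniteDimensional ℝ E] in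
theorem mdifferentiableAt (h : IsIntegralFamily I F Ω O ε c) (hO : IsOpen O) {s : ℝ}
    (hs : s ∈ Ioo (-ε) ε) : ∀ t ∈ O, MDifferentiableAt 𝓘(ℝ, ℝ) I (fun t' => c (t', s)) t :=
  fun t ht => ((h.smooth.slice_fst hs).contMDiffAt (hO.mem_nhds ht)).mdifferentiableAt (by simp)

/-- Families of integral curves which agree at one time can be glued. -/
theorem glue [T2Space M] (hΩ : IsOpen Ω) (hF : ContMDiffOn I I.tangent ∞ F Ω)
    (hF1 : ∀ x ∈ Ω, (F x).1 = x) (h₁ : IsIntegralFamily I F Ω O₁ ε c₁)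
    (h₂ : IsIntegralFamily I F Ω O₂ ε c₂) (hO₁ : IsOpen O₁) (hO₂ : IsOpen O₂)
    (hc₁ : O₁.OrdConnected) (hc₂ : O₂.OrdConnected) {t₁ : ℝ} (ht₁ : t₁ ∈ O₁) (ht₂ : t₁ ∈ O₂)
    (heq : ∀ s ∈ Ioo (-ε) ε, c₁ (t₁, s) = c₂ (t₁, s)) :
    ∃ c, IsIntegralFamily I F Ω (O₁ ∪ O₂) ε c ∧
      ∀ t ∈ O₁, ∀ s ∈ Ioo (-ε) ε, c (t, s) = c₁ (t, s) := by
  classical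
  let c : ℝ × ℝ → M := fun z => if z.1 ∈ O₁ then c₁ z else c₂ z
  have e₁ : ∀ z : ℝ × ℝ, z.1 ∈ O₁ → c z = c₁ z := fun z hz => if_pos hz
  -- The overlap is an open interval containing `t₁`, so uniqueness for each fixed s makes the two
  -- families agree there.
  have e₂ : ∀ t ∈ O₂, ∀ s ∈ Ioo (-ε) ε, c (t, s) = c₂ (t, s) := by
    intro t ht s hs
    by_cases h : t ∈ O₁
    · rw [e₁ _ h]
      exact eqOn_of_velocity_eq hΩ hF hF1 (hO₁.inter hO₂) (hc₁.inter hc₂).isPreconnected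
        (fun t ht => h₁.mdifferentiableAt hO₁ hs t ht.1)
        (fun t ht => h₂.mdifferentiableAt hO₂ hs t ht.2)
        (fun t ht => h₁.mem t ht.1 s hs)
        (fun t ht => h₁.velocity_eq t ht.1 s hs) (fun t ht => h₂.velocity_eq t ht.2 s hs)
        ⟨ht₁, ht₂⟩ (heq s hs) ⟨h, ht⟩
    · exact if_neg h
  refine ⟨c, ⟨?_, ?_, ?_⟩, fun t ht s _ => e₁ _ ht⟩
  · rintro ⟨t, s⟩ ⟨ht, hs⟩
    rcases ht with ht | ht
    · refine ((h₁.smooth.contMDiffAt ((hO₁.prod isOpen_Ioo).mem_nhds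
        ⟨ht, hs⟩)).congr_of_eventuallyEq ?_).contMDiffWithinAt
      filter_upwards [(hO₁.prod isOpen_Ioo).mem_nhds ⟨ht, hs⟩] with z hz using e₁ z hz.1
    · refine ((h₂.smooth.contMDiffAt ((hO₂.prod isOpen_Ioo).mem_nhds
        ⟨ht, hs⟩)).congr_of_eventuallyEq ?_).contMDiffWithinAt
      filter_upwards [(hO₂.prod isOpen_Ioo).mem_nhds ⟨ht, hs⟩] with z hz using e₂ _ hz.1 _ hz.2
  · rintro t (ht | ht) s hs
    · rw [e₁ _ ht]; exact h₁.mem t ht s hs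
    · rw [e₂ t ht s hs]; exact h₂.mem t ht s hs
  · rintro t (ht | ht) s hs
    · rw [e₁ _ ht, ← h₁.velocity_eq t ht s hs]
      refine velocity_congr ?_
      filter_upwards [hO₁.mem_nhds ht] with t' ht' using e₁ _ ht'
    · rw [e₂ t ht s hs, ← h₂.velocity_eq t ht s hs]
      refine velocity_congr ?_
      filter_upwards [hO₂.mem_nhds ht] with t' ht' using e₂ t' ht' s hs

end IsIntegralFamily

omit [I.Boundaryless] [IsManifold I ∞ M] [FiniteDimensional ℝ E] in
theorem velocity_comp_sub_const {c : ℝ → M} {t a : ℝ} :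
    velocity I (fun t' => c (t' - a)) t = velocity I c (t - a) := by
  unfold velocity
  congr 1
  by_cases h : MDifferentiableAt 𝓘(ℝ, ℝ) I c (t - a)
  · have h1 : HasMFDerivAt 𝓘(ℝ, ℝ) 𝓘(ℝ, ℝ) (fun t' : ℝ => t' - a) t
        (ContinuousLinearMap.id ℝ ℝ) := ((hasFDerivAt_id t).sub_const a).hasMFDerivAt
    exact congrArg (fun A : ℝ →L[ℝ] E => A 1)
      (HasMFDerivAt.comp (f := fun t' : ℝ => t' - a) t h.hasMFDerivAt h1).mfderiv
  -- Without differentiability at `t - a` the shifted curve is not differentiable at `t` either, and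
  -- both derivatives have the default value 0.
  · have h' : ¬ MDifferentiableAt 𝓘(ℝ, ℝ) I (fun t' => c (t' - a)) t := by
      intro h'
      apply h
      have h2 : MDifferentiableAt 𝓘(ℝ, ℝ) 𝓘(ℝ, ℝ) (fun t' : ℝ => t' + a) (t - a) :=
        DifferentiableAt.mdifferentiableAt (by fun_prop)
      have h3 := MDifferentiableAt.comp (g := fun t' => c (t' - a)) (f := fun t' : ℝ => t' + a)
        (t - a) (by simpa using h') h2
      simpa [Function.comp_def] using h3
    rw [mfderiv_zero_of_not_mdifferentiableAt h, mfderiv_zero_of_not_mdifferentiableAt h']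
    rfl

/-- Near each time, a curve has a neighbourhood in which integral families can be started at all
times. -/
theorem exists_box {F : M → TangentBundle I M} {Ω : Set M} (hΩ : IsOpen Ω)
    (hF : ContMDiffOn I I.tangent ∞ F Ω) (hF1 : ∀ x ∈ Ω, (F x).1 = x) {O : Set ℝ} (hO : IsOpen O)
    {σ : ℝ → M} (hσ : ContinuousOn σ O) (hm : ∀ t ∈ O, σ t ∈ Ω) {τ : ℝ} (hτ : τ ∈ O) :
    ∃ η > 0, Metric.ball τ η ⊆ O ∧ ∀ b ∈ Metric.ball τ η, ∀ (w : ℝ → M) (ε : ℝ), 0 < ε →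
      ContMDiffOn 𝓘(ℝ, ℝ) I ∞ w (Ioo (-ε) ε) → w 0 = σ b →
      ∃ (ε' : ℝ) (c : ℝ × ℝ → M), 0 < ε' ∧ ε' ≤ ε ∧
        IsIntegralFamily I F Ω (Metric.ball τ η) ε' c ∧ ∀ s ∈ Ioo (-ε') ε', c (b, s) = w s := by
  obtain ⟨Φ, δ, U, hδ, hUo, hqU, hΦ, hΦ2⟩ := exists_local_flow hΩ hF hF1 (hm τ hτ)
  have hev : ∀ᶠ t in 𝓝 τ, t ∈ O ∧ σ t ∈ U := Filter.Eventually.and (hO.mem_nhds hτ)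
    ((hσ.continuousAt (hO.mem_nhds hτ)).eventually (hUo.mem_nhds hqU))
  obtain ⟨η, hη, hηb⟩ := Metric.eventually_nhds_iff_ball.1 hev
  have hsub : Metric.ball τ (min η (δ / 2)) ⊆ Metric.ball τ η :=
    Metric.ball_subset_ball (min_le_left _ _)
  -- With radius at most δ/2, any two times in the ball differ by less than δ, so the flow can be
  -- started at any of them and reaches all others.
  refine ⟨min η (δ / 2), lt_min hη (by linarith), fun t ht => (hηb t (hsub ht)).1,
    fun b hb w ε hε hw hw0 => ?_⟩
  have h0 : (0 : ℝ) ∈ Ioo (-ε) ε := ⟨by linarith, hε⟩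
  have hwU : ∀ᶠ s in 𝓝 (0 : ℝ), w s ∈ U :=
    (hw.continuousOn.continuousAt (isOpen_Ioo.mem_nhds h0)).eventually
      (hUo.mem_nhds (by rw [hw0]; exact (hηb b (hsub hb)).2))
  obtain ⟨ε₁, hε₁, hε₁b⟩ := Metric.eventually_nhds_iff_ball.1 hwU
  have hwm : ∀ s ∈ Ioo (-min ε ε₁) (min ε ε₁), s ∈ Ioo (-ε) ε ∧ w s ∈ U := by
    intro s hs
    rw [mem_Ioo, ← abs_lt, lt_min_iff] at hs
    refine ⟨abs_lt.1 hs.1, hε₁b s ?_⟩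
    rw [mem_ball_zero_iff]; exact hs.2
  have htm : ∀ t ∈ Metric.ball τ (min η (δ / 2)), t - b ∈ Ioo (-δ) δ := by
    intro t ht
    have h1 : dist t τ < δ / 2 := lt_of_lt_of_le ht (min_le_right _ _)
    have h2 : dist b τ < δ / 2 := lt_of_lt_of_le hb (min_le_right _ _)
    have h3 := dist_triangle_right t b τ
    rw [mem_Ioo, ← abs_lt, ← Real.dist_eq]
    linarith
  refine ⟨min ε ε₁, fun z => Φ (z.1 - b, w z.2), lt_min hε hε₁, min_le_left _ _,
    ⟨?_, ?_, ?_⟩, ?_⟩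
  · have a1 : ContMDiffOn 𝓘(ℝ, ℝ × ℝ) 𝓘(ℝ, ℝ) ∞ (fun z : ℝ × ℝ => z.1 - b)
        (Metric.ball τ (min η (δ / 2)) ×ˢ Ioo (-min ε ε₁) (min ε ε₁)) :=
      (ContDiff.contMDiff (by fun_prop)).contMDiffOn
    have a2 : ContMDiffOn 𝓘(ℝ, ℝ × ℝ) I ∞ (fun z : ℝ × ℝ => w z.2)
        (Metric.ball τ (min η (δ / 2)) ×ˢ Ioo (-min ε ε₁) (min ε ε₁)) :=
      hw.comp (ContDiff.contMDiff (f := fun z : ℝ × ℝ => z.2) (by fun_prop)).contMDiffOn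
        fun z hz => (hwm _ hz.2).1
    exact hΦ.comp (a1.prodMk a2) fun z hz => ⟨htm _ hz.1, (hwm _ hz.2).2⟩
  · exact fun t ht s hs => ((hΦ2 _ (hwm s hs).2).2 _ (htm t ht)).1
  · intro t ht s hs
    rw [← ((hΦ2 _ (hwm s hs).2).2 _ (htm t ht)).2]
    exact velocity_comp_sub_const (c := fun t' => Φ (t', w s))
  · intro s hs
    dsimp only
    rw [sub_self]
    exact (hΦ2 _ (hwm s hs).2).1

/-- An integral curve `σ` on an open interval and a curve `w` through `σ(t₀)`: over a
neighbourhood of `[a, b]` there is a smooth family of integral curves with initial values `w`. -/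
theorem exists_integralFamily [T2Space M] {F : M → TangentBundle I M} {Ω : Set M} (hΩ : IsOpen Ω)
    (hF : ContMDiffOn I I.tangent ∞ F Ω) (hF1 : ∀ x ∈ Ω, (F x).1 = x) {O : Set ℝ} (hO : IsOpen O)
    (hOc : O.OrdConnected) {σ : ℝ → M} (hσ : ∀ t ∈ O, MDifferentiableAt 𝓘(ℝ, ℝ) I σ t)
    (hm : ∀ t ∈ O, σ t ∈ Ω) (hv : ∀ t ∈ O, velocity I σ t = F (σ t)) {t₀ : ℝ} (ht₀ : t₀ ∈ O)
    {w : ℝ → M} {ε : ℝ} (hε : 0 < ε) (hw : ContMDiffOn 𝓘(ℝ, ℝ) I ∞ w (Ioo (-ε) ε))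
    (hw0 : w 0 = σ t₀) {a b : ℝ} (ha : a ∈ O) (hb : b ∈ O) :
    ∃ (O' : Set ℝ) (ε' : ℝ) (c : ℝ × ℝ → M), IsOpen O' ∧ O'.OrdConnected ∧ O' ⊆ O ∧ t₀ ∈ O' ∧
      a ∈ O' ∧ b ∈ O' ∧ 0 < ε' ∧ ε' ≤ ε ∧ IsIntegralFamily I F Ω O' ε' c ∧
      (∀ s ∈ Ioo (-ε') ε', c (t₀, s) = w s) ∧ ∀ t ∈ O', c (t, 0) = σ t := by
  have hσc : ContinuousOn σ O := fun t ht => (hσ t ht).continuousAt.continuousWithinAt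
  -- `G b` says that the family exists over an interval joining `t₀` to `b`, for some possibly
  -- smaller ε. The set of such times is shown to be open and closed in `O`.
  let G : ℝ → Prop := fun b => ∃ (O' : Set ℝ) (ε' : ℝ) (c : ℝ × ℝ → M), IsOpen O' ∧
    O'.OrdConnected ∧ O' ⊆ O ∧ t₀ ∈ O' ∧ b ∈ O' ∧ 0 < ε' ∧ ε' ≤ ε ∧
    IsIntegralFamily I F Ω O' ε' c ∧ (∀ s ∈ Ioo (-ε') ε', c (t₀, s) = w s) ∧
    ∀ t ∈ O', c (t, 0) = σ t
  -- The curve s = 0 stays on `σ` by uniqueness; this allows the next box around `σ` to be entered.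
  have hbase : ∀ (O' : Set ℝ) (ε' : ℝ) (c : ℝ × ℝ → M) (t₁ : ℝ), IsOpen O' → O'.OrdConnected →
      O' ⊆ O → t₁ ∈ O' → 0 < ε' → IsIntegralFamily I F Ω O' ε' c → c (t₁, 0) = σ t₁ →
      ∀ t ∈ O', c (t, 0) = σ t := by
    intro O' ε' c t₁ ho hoc hs ht₁ hε' hc h1
    have h0 : (0 : ℝ) ∈ Ioo (-ε') ε' := ⟨by linarith, hε'⟩
    exact eqOn_of_velocity_eq hΩ hF hF1 ho hoc.isPreconnected (hc.mdifferentiableAt ho h0)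
      (fun t ht => hσ t (hs ht)) (fun t ht => hc.mem t ht 0 h0)
      (fun t ht => hc.velocity_eq t ht 0 h0) (fun t ht => hv t (hs ht)) ht₁ h1
  have hball : ∀ τ η : ℝ, (Metric.ball τ η).OrdConnected := fun τ η => by
    rw [Real.ball_eq_Ioo]; exact ordConnected_Ioo
  -- The radius depends only on `τ`, not on the family already constructed. Thus `G` spreads from
  -- any point of the ball to all of it, which yields both openness and closedness.
  have hstep : ∀ τ ∈ O, ∃ η > 0, Metric.ball τ η ⊆ O ∧
      ∀ b ∈ Metric.ball τ η, G b → ∀ b' ∈ Metric.ball τ η, G b' := by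
    intro τ hτ
    obtain ⟨η, hη, hηO, hbox⟩ := exists_box hΩ hF hF1 hO hσc hm hτ
    refine ⟨η, hη, hηO, ?_⟩
    rintro b hb ⟨O', ε', c, ho, hoc, hs, h0, hbO, hε', hle, hc, hcw, hcσ⟩ b' hb'
    obtain ⟨ε₂, c₂, hε₂, hle₂, hc₂, hc₂w⟩ := hbox b hb (fun s => c (b, s)) ε' hε'
      (hc.smooth.slice_snd hbO) (hcσ b hbO)
    obtain ⟨c₃, hc₃, hc₃e⟩ := (hc.mono Subset.rfl hle₂).glue hΩ hF hF1 hc₂ ho Metric.isOpen_ball hoc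
      (hball τ η) hbO hb (fun s hs => (hc₂w s hs).symm)
    have hcon : (O' ∪ Metric.ball τ η).OrdConnected :=
      (IsPreconnected.union b hbO hb hoc.isPreconnected (hball τ η).isPreconnected).ordConnected
    have hop : IsOpen (O' ∪ Metric.ball τ η) := ho.union Metric.isOpen_ball
    have hw' : ∀ s ∈ Ioo (-ε₂) ε₂, c₃ (t₀, s) = w s := fun s hs => by
      rw [hc₃e t₀ h0 s hs]
      exact hcw s (Ioo_subset_Ioo (neg_le_neg hle₂) hle₂ hs)
    exact ⟨O' ∪ Metric.ball τ η, ε₂, c₃, hop, hcon, union_subset hs hηO, Or.inl h0, Or.inr hb',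
      hε₂, hle₂.trans hle, hc₃, hw', hbase _ ε₂ c₃ t₀ hop hcon (union_subset hs hηO) (Or.inl h0)
        hε₂ hc₃ (by rw [hw' 0 ⟨by linarith, hε₂⟩, hw0])⟩
  have hG₀ : G t₀ := by
    obtain ⟨η, hη, hηO, hbox⟩ := exists_box hΩ hF hF1 hO hσc hm ht₀
    have hb := Metric.mem_ball_self (x := t₀) hη
    obtain ⟨ε₂, c₂, hε₂, hle₂, hc₂, hc₂w⟩ := hbox t₀ hb w ε hε hw hw0
    exact ⟨_, ε₂, c₂, Metric.isOpen_ball, hball t₀ η, hηO, hb, hb, hε₂, hle₂, hc₂, hc₂w,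
      hbase _ ε₂ c₂ t₀ Metric.isOpen_ball (hball t₀ η) hηO hb hε₂ hc₂
        (by rw [hc₂w 0 ⟨by linarith, hε₂⟩, hw0])⟩
  have hG : O ⊆ {t | t ∈ O ∧ G t} := by
    refine hOc.isPreconnected.subset_of_closure_inter_subset ?_ ⟨t₀, ht₀, ht₀, hG₀⟩ ?_
    · rw [isOpen_iff_mem_nhds]
      rintro t ⟨ht, hGt⟩
      obtain ⟨η, hη, hηO, h⟩ := hstep t ht
      filter_upwards [Metric.ball_mem_nhds t hη] with t' ht'
      exact ⟨hηO ht', h t (Metric.mem_ball_self hη) hGt t' ht'⟩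
    · rintro t ⟨htc, ht⟩
      obtain ⟨η, hη, hηO, h⟩ := hstep t ht
      obtain ⟨t', ht', hG'⟩ := mem_closure_iff_nhds.1 htc _ (Metric.ball_mem_nhds t hη)
      exact ⟨ht, h t' ht' hG'.2 t (Metric.mem_ball_self hη)⟩
  obtain ⟨O₁, ε₁, c₁, ho₁, hoc₁, hs₁, h0₁, hb₁, hε₁, hle₁, hc₁, hcw₁, hcσ₁⟩ := (hG ha).2
  obtain ⟨O₂, ε₂, c₂, ho₂, hoc₂, hs₂, h0₂, hb₂, hε₂, hle₂, hc₂, hcw₂, hcσ₂⟩ := (hG hb).2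
  have hI₁ : Ioo (-min ε₁ ε₂) (min ε₁ ε₂) ⊆ Ioo (-ε₁) ε₁ :=
    Ioo_subset_Ioo (neg_le_neg (min_le_left _ _)) (min_le_left _ _)
  have hI₂ : Ioo (-min ε₁ ε₂) (min ε₁ ε₂) ⊆ Ioo (-ε₂) ε₂ :=
    Ioo_subset_Ioo (neg_le_neg (min_le_right _ _)) (min_le_right _ _)
  have hε' : 0 < min ε₁ ε₂ := lt_min hε₁ hε₂
  -- The families reaching `a` and `b` have the same values `w` at `t₀`, so they glue there.
  obtain ⟨c, hc, hce⟩ := (hc₁.mono Subset.rfl (min_le_left _ _)).glue hΩ hF hF1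
    (hc₂.mono Subset.rfl (min_le_right _ _)) ho₁ ho₂ hoc₁ hoc₂ h0₁ h0₂
    (fun s hs => (hcw₁ s (hI₁ hs)).trans (hcw₂ s (hI₂ hs)).symm)
  have hcon : (O₁ ∪ O₂).OrdConnected :=
    (IsPreconnected.union t₀ h0₁ h0₂ hoc₁.isPreconnected hoc₂.isPreconnected).ordConnected
  have hw' : ∀ s ∈ Ioo (-min ε₁ ε₂) (min ε₁ ε₂), c (t₀, s) = w s := fun s hs => by
    rw [hce t₀ h0₁ s hs]; exact hcw₁ s (hI₁ hs)
  exact ⟨O₁ ∪ O₂, min ε₁ ε₂, c, ho₁.union ho₂, hcon, union_subset hs₁ hs₂, Or.inl h0₁, Or.inl hb₁,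
    Or.inr hb₂, hε', (min_le_left _ _).trans hle₁, hc, hw',
    hbase _ _ c t₀ (ho₁.union ho₂) hcon (union_subset hs₁ hs₂) (Or.inl h0₁) hε' hc
      (by rw [hw' 0 ⟨by linarith, hε'⟩, hw0])⟩

omit [FiniteDimensional ℝ E] in
/-- Every tangent vector is the velocity of a smooth curve. -/
theorem exists_curve_velocity_eq (ξ : TangentBundle I M) :
    ∃ (w : ℝ → M) (ε : ℝ), 0 < ε ∧ ContMDiffOn 𝓘(ℝ, ℝ) I ∞ w (Ioo (-ε) ε) ∧ w 0 = ξ.1 ∧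
      velocity I w 0 = ξ := by
  set φ := extChartAt I ξ.1 with hφ
  let v : E := ξ.2
  let l : ℝ → E := fun s => φ ξ.1 + s • v
  have hl : ContDiff ℝ ∞ l := by fun_prop
  have hl0 : l 0 = φ ξ.1 := by simp [l]
  have hev : ∀ᶠ s in 𝓝 (0 : ℝ), l s ∈ φ.target :=
    hl.continuous.continuousAt.eventually
      ((isOpen_extChartAt_target ξ.1).mem_nhds (by rw [hl0]; exact mem_extChartAt_target ξ.1))
  obtain ⟨ε, hε, hb⟩ := Metric.eventually_nhds_iff_ball.1 hev
  rw [Real.ball_eq_Ioo, zero_sub, zero_add] at hb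
  have h0 : (0 : ℝ) ∈ Ioo (-ε) ε := ⟨by linarith, hε⟩
  have hw : ContMDiffOn 𝓘(ℝ, ℝ) I ∞ (φ.symm ∘ l) (Ioo (-ε) ε) :=
    (contMDiffOn_extChartAt_symm ξ.1).comp hl.contMDiff.contMDiffOn hb
  have hw0 : (φ.symm ∘ l) 0 = ξ.1 := by
    rw [Function.comp_apply, hl0]; exact extChartAt_to_inv ξ.1
  have hmd : MDifferentiableAt 𝓘(ℝ, ℝ) I (φ.symm ∘ l) 0 :=
    (hw.contMDiffAt (isOpen_Ioo.mem_nhds h0)).mdifferentiableAt (by simp)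
  refine ⟨φ.symm ∘ l, ε, hε, hw, hw0, ?_⟩
  have hd : deriv (φ ∘ φ.symm ∘ l) 0 = v := by
    have h1 : HasDerivAt l v 0 := by
      simpa [l] using ((hasDerivAt_id (0 : ℝ)).smul_const v).const_add (φ ξ.1)
    refine (h1.congr_of_eventuallyEq ?_).deriv
    filter_upwards [isOpen_Ioo.mem_nhds h0] with s hs using φ.right_inv (hb s hs)
  have h2 := velocity_eq hmd
  rw [hw0] at h2
  exact h2.trans (congrArg (fun y : E => (⟨ξ.1, y⟩ : TangentBundle I M)) hd)

end IntegralCurves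

/-! ### Mixed tangent vectors of maps of two variables -/

section Families

variable {E H : Type} {M : Type u} [NormedAddCommGroup E] [NormedSpace ℝ E] [TopologicalSpace H]
  {I : ModelWithCorners ℝ E H} [TopologicalSpace M] [ChartedSpace H M] [IsManifold I ∞ M]
  {c : ℝ × ℝ → M} {W : Set (ℝ × ℝ)}

/-- This is the tangent map of `c` along the constant field `v`. With v = (1, 0) and (0, 1) it gives
joint smoothness of the partial tangent curves. -/
theorem contMDiffOn_directional (hW : IsOpen W) (hc : ContMDiffOn 𝓘(ℝ, ℝ × ℝ) I ∞ c W) (v : ℝ × ℝ) :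
    ContMDiffOn 𝓘(ℝ, ℝ × ℝ) I.tangent ∞
      (fun z => (⟨c z, mfderiv 𝓘(ℝ, ℝ × ℝ) I c z v⟩ : TangentBundle I M)) W := by
  have h1 := hc.contMDiffOn_tangentMapWithin (m := ∞) (by simp) hW.uniqueMDiffOn
  have h2 : ContMDiff 𝓘(ℝ, ℝ × ℝ) 𝓘(ℝ, ℝ × ℝ).tangent ∞
      (fun z => (⟨z, v⟩ : TangentBundle 𝓘(ℝ, ℝ × ℝ) (ℝ × ℝ))) :=
    contMDiff_vectorSpace_iff_contDiff.2 contDiff_const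
  refine (h1.comp h2.contMDiffOn fun z hz => hz).congr fun z hz => ?_
  exact (tangentMapWithin_eq_tangentMap (p := (⟨z, v⟩ : TangentBundle 𝓘(ℝ, ℝ × ℝ) (ℝ × ℝ)))
    (hW.uniqueMDiffWithinAt hz)
    ((hc.contMDiffAt (hW.mem_nhds hz)).mdifferentiableAt (by simp))).symm

theorem contMDiffOn_velocity_snd (hW : IsOpen W) (hc : ContMDiffOn 𝓘(ℝ, ℝ × ℝ) I ∞ c W) :
    ContMDiffOn 𝓘(ℝ, ℝ × ℝ) I.tangent ∞ (fun z => velocity I (fun s => c (z.1, s)) z.2) W := by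
  refine (contMDiffOn_directional hW hc (0, 1)).congr fun z hz => ?_
  have h1 : HasMFDerivAt 𝓘(ℝ, ℝ) 𝓘(ℝ, ℝ × ℝ) (fun s : ℝ => (z.1, s)) z.2
      (ContinuousLinearMap.inr ℝ ℝ ℝ) := (hasFDerivAt_prodMk_right z.1 z.2).hasMFDerivAt
  have h2 := ((hc.contMDiffAt (hW.mem_nhds hz)).mdifferentiableAt (by simp)).hasMFDerivAt
  have h3 := (HasMFDerivAt.comp (f := fun s : ℝ => (z.1, s)) z.2 h2 h1).mfderiv
  exact congrArg (fun A : ℝ →L[ℝ] E => (⟨c z, A 1⟩ : TangentBundle I M)) h3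

theorem contMDiffOn_velocity_fst (hW : IsOpen W) (hc : ContMDiffOn 𝓘(ℝ, ℝ × ℝ) I ∞ c W) :
    ContMDiffOn 𝓘(ℝ, ℝ × ℝ) I.tangent ∞ (fun z => velocity I (fun t => c (t, z.2)) z.1) W := by
  refine (contMDiffOn_directional hW hc (1, 0)).congr fun z hz => ?_
  have h1 : HasMFDerivAt 𝓘(ℝ, ℝ) 𝓘(ℝ, ℝ × ℝ) (fun t : ℝ => (t, z.2)) z.1
      (ContinuousLinearMap.inl ℝ ℝ ℝ) := (hasFDerivAt_prodMk_left z.1 z.2).hasMFDerivAt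
  have h2 := ((hc.contMDiffAt (hW.mem_nhds hz)).mdifferentiableAt (by simp)).hasMFDerivAt
  have h3 := (HasMFDerivAt.comp (f := fun t : ℝ => (t, z.2)) z.1 h2 h1).mfderiv
  exact congrArg (fun A : ℝ →L[ℝ] E => (⟨c z, A 1⟩ : TangentBundle I M)) h3

/-- The mixed second tangent vectors of a map of two variables, in the coordinates induced by any
chart of the base. -/
theorem extChartAt_velocity_velocity {t s : ℝ} (hW : IsOpen W)
    (hc : ContMDiffOn 𝓘(ℝ, ℝ × ℝ) I ∞ c W) (hz : (t, s) ∈ W)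
    (p : TangentBundle I.tangent (TangentBundle I M)) (hp : c (t, s) ∈ (chartAt H p.1.1).source) :
    extChartAt I.tangent.tangent p
        (velocity I.tangent (fun t' => velocity I (fun s' => c (t', s')) s) t) =
      ((extChartAt I p.1.1 (c (t, s)), deriv (fun s' => extChartAt I p.1.1 (c (t, s'))) s),
        (deriv (fun t' => extChartAt I p.1.1 (c (t', s))) t,
          deriv (fun t' => deriv (fun s' => extChartAt I p.1.1 (c (t', s'))) s) t)) := by
  have m1 : ∀ z ∈ W, MDifferentiableAt 𝓘(ℝ, ℝ) I (fun s' => c (z.1, s')) z.2 := fun z hz =>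
    MDifferentiableAt.comp (g := c) (f := fun s' : ℝ => (z.1, s')) z.2
      ((hc.contMDiffAt (hW.mem_nhds hz)).mdifferentiableAt (by simp))
      (DifferentiableAt.mdifferentiableAt (by fun_prop))
  have m2 : MDifferentiableAt 𝓘(ℝ, ℝ) I.tangent
      (fun t' => velocity I (fun s' => c (t', s')) s) t :=
    MDifferentiableAt.comp (g := fun z : ℝ × ℝ => velocity I (fun s => c (z.1, s)) z.2)
      (f := fun t' : ℝ => (t', s)) t
      (((contMDiffOn_velocity_snd hW hc).contMDiffAt (hW.mem_nhds hz)).mdifferentiableAt (by simp))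
      (DifferentiableAt.mdifferentiableAt (by fun_prop))
  have e1 := extChartAt_velocity m2 p ((TangentBundle.mem_chart_source_iff _ _).2 hp)
  have hF : ContDiffAt ℝ 2 (fun q => extChartAt I p.1.1 (c q)) (t, s) :=
    (((contMDiffOn_extChartAt (I := I) (n := ∞) (x := p.1.1)).contMDiffAt
      ((chartAt H p.1.1).open_source.mem_nhds hp)).comp (t, s)
        (hc.contMDiffAt (hW.mem_nhds hz))).contDiffAt.of_le (WithTop.coe_le_coe.2 le_top)
  have hev : (extChartAt I.tangent p.1 ∘ fun t' => velocity I (fun s' => c (t', s')) s) =ᶠ[𝓝 t]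
      fun t' => (extChartAt I p.1.1 (c (t', s)),
        deriv (fun s' => extChartAt I p.1.1 (c (t', s'))) s) := by
    have hcc : ContinuousAt c (t, s) := (hc.contMDiffAt (hW.mem_nhds hz)).continuousAt
    filter_upwards [eventually_slice_fst (hW.mem_nhds hz), eventually_slice_fst
      (hcc.eventually ((chartAt H p.1.1).open_source.mem_nhds hp))] with t' h1 h2
    exact extChartAt_velocity (m1 (t', s) h1) p.1 h2
  have hd : HasDerivAt (fun t' => (extChartAt I p.1.1 (c (t', s)),
        deriv (fun s' => extChartAt I p.1.1 (c (t', s'))) s)) _ t :=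
    ((DifferentiableAt.comp (f := fun t' : ℝ => (t', s)) t (hF.differentiableAt (by simp))
      (by fun_prop)).hasDerivAt).prodMk (pderiv_comm hF).1.hasDerivAt
  refine e1.trans (Prod.ext hev.self_of_nhds ?_)
  rw [hev.deriv_eq]
  exact hd.deriv

variable [I.Boundaryless]

/-- Every second tangent vector is the mixed second tangent vector of a map of two variables. -/
theorem exists_velocity_velocity_eq (ξ : TangentBundle I.tangent (TangentBundle I M)) :
    ∃ (c : ℝ × ℝ → M) (W : Set (ℝ × ℝ)), IsOpen W ∧ (0, 0) ∈ W ∧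
      ContMDiffOn 𝓘(ℝ, ℝ × ℝ) I ∞ c W ∧ c (0, 0) = ξ.1.1 ∧
      velocity I.tangent (fun t => velocity I (fun s => c (t, s)) 0) 0 = ξ := by
  set φ := extChartAt I ξ.1.1 with hφ
  let y : E := ξ.1.2
  let v : E := (show E × E from ξ.2).1
  let w : E := (show E × E from ξ.2).2
  -- In the chart, this polynomial has ∂ₛ = y, ∂ₜ = v and ∂ₜ∂ₛ = w at the origin.
  let l : ℝ × ℝ → E := fun z => φ ξ.1.1 + (z.1 • v + z.2 • (y + z.1 • w))
  have hl : ContDiff ℝ ∞ l := by fun_prop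
  have hl0 : l (0, 0) = φ ξ.1.1 := by simp [l]
  have hWo : IsOpen (l ⁻¹' φ.target) := (isOpen_extChartAt_target ξ.1.1).preimage hl.continuous
  have h0 : ((0 : ℝ), (0 : ℝ)) ∈ l ⁻¹' φ.target := by
    rw [mem_preimage, hl0]; exact mem_extChartAt_target ξ.1.1
  have hc : ContMDiffOn 𝓘(ℝ, ℝ × ℝ) I ∞ (φ.symm ∘ l) (l ⁻¹' φ.target) :=
    (contMDiffOn_extChartAt_symm ξ.1.1).comp hl.contMDiff.contMDiffOn fun z hz => hz
  have hc0 : (φ.symm ∘ l) (0, 0) = ξ.1.1 := by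
    rw [Function.comp_apply, hl0]; exact extChartAt_to_inv ξ.1.1
  refine ⟨φ.symm ∘ l, l ⁻¹' φ.target, hWo, h0, hc, hc0, ?_⟩
  have hinv : ∀ z ∈ l ⁻¹' φ.target, φ ((φ.symm ∘ l) z) = l z := fun z hz => φ.right_inv hz
  have d1 : ∀ t, HasDerivAt (fun s => l (t, s)) (y + t • w) 0 := fun t => by
    simpa [l] using ((((hasDerivAt_id (0 : ℝ)).smul_const (y + t • w)).const_add
      (t • v)).const_add (φ ξ.1.1))
  have e1 : ∀ t, (t, (0 : ℝ)) ∈ l ⁻¹' φ.target →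
      deriv (fun s => φ ((φ.symm ∘ l) (t, s))) 0 = y + t • w := fun t ht => by
    refine ((d1 t).congr_of_eventuallyEq ?_).deriv
    filter_upwards [eventually_slice_snd (hWo.mem_nhds ht)] with s hs using hinv _ hs
  have e2 : deriv (fun t => φ ((φ.symm ∘ l) (t, 0))) 0 = v := by
    have h1 : HasDerivAt (fun t => l (t, 0)) v 0 := by
      simpa [l] using (((hasDerivAt_id (0 : ℝ)).smul_const v).const_add (φ ξ.1.1))
    refine (h1.congr_of_eventuallyEq ?_).deriv
    filter_upwards [eventually_slice_fst (hWo.mem_nhds h0)] with t ht using hinv _ ht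
  have e3 : deriv (fun t => deriv (fun s => φ ((φ.symm ∘ l) (t, s))) 0) 0 = w := by
    have h1 : HasDerivAt (fun t : ℝ => y + t • w) w 0 := by
      simpa using ((hasDerivAt_id (0 : ℝ)).smul_const w).const_add y
    refine (h1.congr_of_eventuallyEq ?_).deriv
    filter_upwards [eventually_slice_fst (hWo.mem_nhds h0)] with t ht using e1 t ht
  have hmd : ∀ z ∈ l ⁻¹' φ.target, MDifferentiableAt 𝓘(ℝ, ℝ × ℝ) I (φ.symm ∘ l) z :=
    fun z hz => (hc.contMDiffAt (hWo.mem_nhds hz)).mdifferentiableAt (by simp)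
  -- The chart in `velocity_velocity` is taken at `c (0, 0)`, which equals `ξ.1.1` only
  -- propositionally; generalizing the base point permits the substitution.
  have key : ∀ x : M, x = ξ.1.1 →
      (⟨⟨x, deriv (fun s => extChartAt I x ((φ.symm ∘ l) (0, s))) 0⟩,
        (deriv (fun t => extChartAt I x ((φ.symm ∘ l) (t, 0))) 0,
          deriv (fun t => deriv (fun s => extChartAt I x ((φ.symm ∘ l) (t, s))) 0) 0)⟩ :
        TangentBundle I.tangent (TangentBundle I M)) = ξ := by
    rintro _ rfl
    let f : E → E → E → TangentBundle I.tangent (TangentBundle I M) := fun a b d =>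
      ⟨⟨ξ.1.1, a⟩, (b, d)⟩
    have h1 := e1 0 h0
    rw [zero_smul, add_zero] at h1
    exact (congr (congr (congrArg f h1) e2) e3).trans rfl
  refine (velocity_velocity (I := I) (δ := fun t s => (φ.symm ∘ l) (t, s)) (t := 0) (s := 0)
    ?_ ?_ ?_).trans (key _ hc0)
  · filter_upwards [eventually_slice_fst (hWo.mem_nhds h0)] with t ht
    exact MDifferentiableAt.comp (g := φ.symm ∘ l) (f := fun s : ℝ => (t, s)) 0 (hmd _ ht)
      (DifferentiableAt.mdifferentiableAt (by fun_prop))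
  · exact MDifferentiableAt.comp (g := φ.symm ∘ l) (f := fun t : ℝ => (t, (0 : ℝ))) 0 (hmd _ h0)
      (DifferentiableAt.mdifferentiableAt (by fun_prop))
  · have hF : ContDiffAt ℝ 2 (fun q => extChartAt I ((φ.symm ∘ l) (0, 0)) ((φ.symm ∘ l) q))
        (0, 0) :=
      ((contMDiffAt_extChartAt (I := I) (n := ∞) (x := (φ.symm ∘ l) (0, 0))).comp (0, 0)
        (hc.contMDiffAt (hWo.mem_nhds h0))).contDiffAt.of_le (WithTop.coe_le_coe.2 le_top)
    exact (pderiv_comm hF).1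

end Families

/-! ### Tangent maps, the slashed bundle and the canonical involution -/

namespace Mfd

variable {X Y Z B : Mfd.{u}}

theorem contMDiff_proj (X : Mfd.{u}) : ContMDiff X.tangent.I X.I ∞ X.proj := by
  have h : ContMDiff X.I.tangent X.I ∞ (fun ξ : TangentBundle X.I X => ξ.1) :=
    Bundle.contMDiff_proj (TangentSpace X.I : X → Type)
  exact h

theorem contMDiff_toBase (X : Mfd.{u}) : ∀ r, ContMDiff (X.iter r).I X.I ∞ (X.toBase r)
  | 0 => contMDiff_id
  | r + 1 => (contMDiff_toBase X r).comp (contMDiff_proj (X.iter r))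

instance t2Space_tangent [T2Space X] : T2Space X.tangent := t2Space_tangentBundle (I := X.I)

theorem t2Space_iter (X : Mfd.{u}) [T2Space X] : ∀ r, T2Space (X.iter r)
  | 0 => inferInstanceAs (T2Space X)
  | r + 1 => have := t2Space_iter X r; t2Space_tangent

theorem vel_comp {f : X → Y} {γ : ℝ → X} {t : ℝ} (hf : MDifferentiableAt X.I Y.I f (γ t))
    (hγ : MDifferentiableAt 𝓘(ℝ, ℝ) X.I γ t) : vel (fun t => f (γ t)) t = D f (vel γ t) :=
  congrArg (fun v : Y.E => (⟨f (γ t), v⟩ : TangentBundle Y.I Y)) (mfderiv_comp_apply t hf hγ (1 : ℝ))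

theorem D_comp {f : X → Y} {g : Y → Z} {ξ : X.tangent} (hg : MDifferentiableAt Y.I Z.I g (f (X.proj ξ)))
    (hf : MDifferentiableAt X.I Y.I f (X.proj ξ)) : D (g ∘ f) ξ = D g (D f ξ) :=
  tangentMap_comp_at (I := X.I) (I' := Y.I) (I'' := Z.I) ξ hg hf

theorem D_eq_self {f : X → X} {ξ : X.tangent} (h : f =ᶠ[𝓝 (X.proj ξ)] id) : D f ξ = ξ := by
  have h1 : mfderiv X.I X.I f (X.proj ξ) = mfderiv X.I X.I id (X.proj ξ) := h.mfderiv_eq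
  rw [mfderiv_id] at h1
  exact Bundle.TotalSpace.ext h.self_of_nhds
    (heq_of_eq (congrArg (fun A : X.E →L[ℝ] X.E => A ξ.2) h1))

theorem contMDiffOn_D {f : X → Y} {U : Set X} (hU : IsOpen U) (hf : ContMDiffOn X.I Y.I ∞ f U) :
    ContMDiffOn X.tangent.I Y.tangent.I ∞ (D f) (X.proj ⁻¹' U) := by
  have h := hf.contMDiffOn_tangentMapWithin (m := ∞) (by simp) hU.uniqueMDiffOn
  refine h.congr fun ξ hξ => ?_
  exact (tangentMapWithin_eq_tangentMap (hU.uniqueMDiffWithinAt hξ)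
    ((hf.contMDiffAt (hU.mem_nhds hξ)).mdifferentiableAt (by simp))).symm

/-- The complement is the preimage under Dp of the zero section, which is closed because the tangent
bundle of `B` is Hausdorff. -/
theorem isOpen_slashed [T2Space B] {p : X → B} (hp : ContMDiff X.I B.I ∞ p) :
    IsOpen (slashed p) := by
  have h1 : ContMDiff X.tangent.I B.tangent.I ∞ (D p) := by
    have := contMDiffOn_D isOpen_univ hp.contMDiffOn
    exact contMDiffOn_univ.1 this
  have h2 : Continuous fun b : B => (⟨b, 0⟩ : TangentBundle B.I B) :=
    (Bundle.contMDiff_zeroSection (IB := B.I) (n := ∞) ℝ (TangentSpace B.I : B → Type)).continuous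
  have h3 : IsClosed {η : B.tangent | (show B.tangent from (⟨B.proj η, 0⟩ : TangentBundle B.I B)) = η} :=
    isClosed_eq (X := B.tangent) (Y := B.tangent) (h2.comp (contMDiff_proj B).continuous)
      continuous_id
  have h4 : slashed p = (D p ⁻¹' {η : B.tangent | (show B.tangent from (⟨B.proj η, 0⟩ : TangentBundle B.I B)) = η})ᶜ := by
    ext ξ
    refine not_congr ⟨fun h => ?_, fun h => ?_⟩
    · exact Bundle.TotalSpace.ext rfl (heq_of_eq h.symm)
    · exact (congrArg (fun η : TangentBundle B.I B => (show B.E from η.2)) h).symm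
  rw [h4]
  exact (h3.preimage h1.continuous).isOpen_compl

theorem flip_flip (ξ : X.tangent.tangent) : X.flip (X.flip ξ) = ξ := rfl

/-- In the coordinates induced by a chart of the base, the canonical involution exchanges the two
middle components. -/
theorem extChartAt_flip (p ξ : X.tangent.tangent)
    (hξ : X.proj (X.tangent.proj ξ) ∈ (chartAt X.H (X.proj (X.tangent.proj p))).source) :
    ∃ a b d e : X.E, extChartAt X.tangent.tangent.I p ξ = (((a, b), (d, e)) : (X.E × X.E) × X.E × X.E) ∧
      extChartAt X.tangent.tangent.I p (X.flip ξ) = (((a, d), (b, e)) : (X.E × X.E) × X.E × X.E) := by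
  obtain ⟨c, W, hW, h0, hc, hc0, hv⟩ := exists_velocity_velocity_eq (I := X.I) ξ
  have hp : c (0, 0) ∈ (chartAt X.H (X.proj (X.tangent.proj p))).source := by rw [hc0]; exact hξ
  have h1 := extChartAt_velocity_velocity hW hc h0 p hp
  -- If ξ = ∂ₜ∂ₛc, then κ(ξ) is the same expression for `c` with its arguments swapped. Both are
  -- computed in the chart at `p`, and symmetry of second derivatives matches the last components.
  let sw : ℝ × ℝ → ℝ × ℝ := Prod.swap
  have hW' : IsOpen (sw ⁻¹' W) := hW.preimage continuous_swap
  have hc' : ContMDiffOn 𝓘(ℝ, ℝ × ℝ) X.I ∞ (c ∘ sw) (sw ⁻¹' W) :=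
    hc.comp (ContDiff.contMDiff (contDiff_snd.prodMk contDiff_fst)).contMDiffOn fun z hz => hz
  have h2 := extChartAt_velocity_velocity hW' hc' (t := 0) (s := 0) h0 p hp
  have hflip : velocity X.I.tangent (fun t => velocity X.I (fun s => (c ∘ sw) (t, s)) 0) 0 =
      X.flip ξ := by
    have h3 := flip_vel_vel (X := X) (hc.contMDiffAt (hW.mem_nhds h0))
    have h4 := congrArg X.flip h3
    rw [flip_flip] at h4
    exact h4.symm.trans (congrArg X.flip hv)
  have hF : ContDiffAt ℝ 2 (fun q => extChartAt X.I (X.proj (X.tangent.proj p)) (c q)) (0, 0) :=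
    (((contMDiffOn_extChartAt (I := X.I) (n := ∞) (x := X.proj (X.tangent.proj p))).contMDiffAt
      ((chartAt X.H (X.proj (X.tangent.proj p))).open_source.mem_nhds hp)).comp ((0 : ℝ), (0 : ℝ))
        (hc.contMDiffAt (hW.mem_nhds h0))).contDiffAt.of_le (WithTop.coe_le_coe.2 le_top)
  have hcomm := (pderiv_comm hF).2.2
  rw [hv] at h1
  rw [hflip] at h2
  refine ⟨_, _, _, _, h1, h2.trans ?_⟩
  exact congrArg (fun e : X.E => (((_, _), (_, e)) : (X.E × X.E) × X.E × X.E)) hcomm.symm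

/-- The definition of `flip` uses a preferred chart that varies with the point, so smoothness is not
visible from it. In the fixed chart at `p`, `extChartAt_flip` shows the map to be a linear
permutation of coordinates. -/
theorem contMDiff_flip (X : Mfd.{u}) :
    ContMDiff X.tangent.tangent.I X.tangent.tangent.I ∞ X.flip := by
  intro p
  have hsrc : ∀ ξ : X.tangent.tangent, ξ ∈ (extChartAt X.tangent.tangent.I p).source ↔
      X.proj (X.tangent.proj ξ) ∈ (chartAt X.H (X.proj (X.tangent.proj p))).source := by
    intro ξ
    rw [extChartAt_source]
    have h : ∀ η q : TangentBundle X.I.tangent (TangentBundle X.I X),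
        η ∈ (chartAt (ModelProd (ModelProd X.H X.E) (X.E × X.E)) q).source ↔
          η.1.1 ∈ (chartAt X.H q.1.1).source := fun η q => by
      rw [TangentBundle.mem_chart_source_iff, TangentBundle.mem_chart_source_iff]
    exact h ξ p
  let τ₀ : (X.E × X.E) × X.E × X.E → (X.E × X.E) × X.E × X.E :=
    fun y => ((y.1.1, y.2.1), (y.1.2, y.2.2))
  let τ : X.tangent.tangent.E → X.tangent.tangent.E := τ₀
  have hτ : ContMDiff 𝓘(ℝ, (X.E × X.E) × X.E × X.E) 𝓘(ℝ, (X.E × X.E) × X.E × X.E) ∞ τ₀ :=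
    ContDiff.contMDiff (by fun_prop)
  have hcoord : ∀ ξ ∈ (extChartAt X.tangent.tangent.I p).source,
      extChartAt X.tangent.tangent.I p (X.flip ξ) = τ (extChartAt X.tangent.tangent.I p ξ) := by
    intro ξ hξ
    obtain ⟨a, b, d, e, h1, h2⟩ := extChartAt_flip p ξ ((hsrc ξ).1 hξ)
    rw [h2, h1]
  have hflip : ∀ ξ ∈ (extChartAt X.tangent.tangent.I p).source,
      X.flip ξ ∈ (extChartAt X.tangent.tangent.I p).source :=
    fun ξ hξ => (hsrc _).2 ((hsrc ξ).1 hξ)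
  have hsm : ContMDiffOn X.tangent.tangent.I X.tangent.tangent.I ∞
      (fun ξ => (extChartAt X.tangent.tangent.I p).symm (τ (extChartAt X.tangent.tangent.I p ξ)))
      (extChartAt X.tangent.tangent.I p).source := by
    have a1 : ContMDiffOn X.tangent.tangent.I 𝓘(ℝ, X.tangent.tangent.E) ∞
        (extChartAt X.tangent.tangent.I p) (extChartAt X.tangent.tangent.I p).source := by
      rw [extChartAt_source]; exact contMDiffOn_extChartAt
    have a2 : ContMDiff 𝓘(ℝ, X.tangent.tangent.E) 𝓘(ℝ, X.tangent.tangent.E) ∞ τ := hτ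
    refine (contMDiffOn_extChartAt_symm p).comp (a2.comp_contMDiffOn a1) fun ξ hξ => ?_
    change τ (extChartAt X.tangent.tangent.I p ξ) ∈ (extChartAt X.tangent.tangent.I p).target
    rw [← hcoord ξ hξ]
    exact (extChartAt X.tangent.tangent.I p).map_source (hflip ξ hξ)
  have hn : (extChartAt X.tangent.tangent.I p).source ∈ 𝓝 p := extChartAt_source_mem_nhds p
  refine (hsm.contMDiffAt hn).congr_of_eventuallyEq ?_
  filter_upwards [hn] with ξ hξ
  rw [← hcoord ξ hξ, (extChartAt X.tangent.tangent.I p).left_inv (hflip ξ hξ)]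

/-- For ξ = ∂ₜ∂ₛc at the origin, both sides are ∂ₜc. -/
theorem proj_flip (ξ : X.tangent.tangent) : X.tangent.proj (X.flip ξ) = D X.proj ξ := by
  obtain ⟨c, W, hW, h0, hc, hc0, hv⟩ := exists_velocity_velocity_eq (I := X.I) ξ
  have h1 := flip_vel_vel (X := X) (hc.contMDiffAt (hW.mem_nhds h0))
  have h2 : X.tangent.proj (X.flip ξ) = vel (fun t => c (t, 0)) 0 :=
    congrArg X.tangent.proj (congrArg X.flip (hv.symm.trans h1))
  have hm : MDifferentiableAt 𝓘(ℝ, ℝ) X.I.tangent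
      (fun t' => velocity X.I (fun s' => c (t', s')) 0) 0 :=
    MDifferentiableAt.comp (g := fun z : ℝ × ℝ => velocity X.I (fun s => c (z.1, s)) z.2)
      (f := fun t' : ℝ => (t', (0 : ℝ))) 0
      (((contMDiffOn_velocity_snd hW hc).contMDiffAt (hW.mem_nhds h0)).mdifferentiableAt (by simp))
      (DifferentiableAt.mdifferentiableAt (by fun_prop))
  have h3 := vel_comp (X := X.tangent) (Y := X) (f := X.proj)
    ((contMDiff_proj X).mdifferentiable (by simp) _) hm
  rw [h2, ← hv]
  exact h3

end Mfd

/-! ### The complete lift and Jacobi fields -/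

namespace Mfd

variable {X B : Mfd.{u}} {p : X → B} {S : X.tangent → X.tangent.tangent}

theorem contMDiffAt_D_flip (ξ : X.tangent.tangent.tangent) :
    ContMDiffAt X.tangent.tangent.tangent.I X.tangent.tangent.tangent.I ∞ (D X.flip) ξ :=
  (contMDiffOn_D isOpen_univ (contMDiff_flip X).contMDiffOn).contMDiffAt univ_mem

/-- D(p ∘ π) = Dp ∘ Dπ, and Dπ(ξ) = π(κ(ξ)) by `proj_flip`. Hence DS is evaluated at κ(ξ) over a
point where S is smooth. -/
theorem proj_flip_mem_slashed (hp : ContMDiff X.I B.I ∞ p) {ξ : X.tangent.tangent}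
    (hξ : ξ ∈ slashed (p ∘ X.proj)) : X.tangent.proj (X.flip ξ) ∈ slashed p := by
  rw [proj_flip]
  have h : D (p ∘ X.proj) ξ = D p (D X.proj ξ) :=
    D_comp (hp.mdifferentiable (by simp) _) ((contMDiff_proj X).mdifferentiable (by simp) _)
  unfold slashed at hξ ⊢
  rw [mem_ofPred_eq, h] at hξ
  exact hξ

theorem IsSpray.contMDiffOn_completeLift [T2Space B] (hp : ContMDiff X.I B.I ∞ p)
    (hS : IsSpray p S) :
    ContMDiffOn X.tangent.tangent.I X.tangent.tangent.tangent.I ∞ (completeLift S)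
      (slashed (p ∘ X.proj)) := by
  have h1 := contMDiffOn_D (isOpen_slashed hp) hS.smooth
  have h2 := h1.comp (contMDiff_flip X).contMDiffOn
    (s := slashed (p ∘ X.proj)) fun ξ hξ => proj_flip_mem_slashed hp hξ
  have h3 := (contMDiff_flip X.tangent).comp_contMDiffOn h2
  exact fun ξ hξ => (contMDiffAt_D_flip _).comp_contMDiffWithinAt ξ (h3 ξ hξ)

/-- The projection of S^c(ξ) is κ(π(κ(DS(κ(ξ))))) = κ(Dπ(DS(κ(ξ)))) = κ(D(π ∘ S)(κ(ξ))) = κ(κ(ξ)) =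
ξ. So S^c is a vector field, as uniqueness of its integral curves requires. -/
theorem IsSpray.proj_completeLift [T2Space B] (hp : ContMDiff X.I B.I ∞ p) (hS : IsSpray p S)
    {ξ : X.tangent.tangent} (hξ : ξ ∈ slashed (p ∘ X.proj)) :
    X.tangent.tangent.proj (completeLift S ξ) = ξ := by
  have hm := proj_flip_mem_slashed hp hξ
  have hn := (isOpen_slashed hp).mem_nhds hm
  have h1 : X.tangent.tangent.proj (completeLift S ξ) =
      X.flip (X.tangent.tangent.proj (X.tangent.flip (D S (X.flip ξ)))) := rfl
  have h2 : D (X.tangent.proj ∘ S) (X.flip ξ) = D X.tangent.proj (D S (X.flip ξ)) :=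
    D_comp ((contMDiff_proj X.tangent).mdifferentiable (by simp) _)
      ((hS.smooth.contMDiffAt hn).mdifferentiableAt (by simp))
  have h3 : D (X.tangent.proj ∘ S) (X.flip ξ) = X.flip ξ :=
    D_eq_self (Filter.mem_of_superset hn fun η hη => hS.vectorField η hη)
  rw [h1, proj_flip, ← h2, h3, flip_flip]

theorem vel_congr {γ γ' : ℝ → X} {t : ℝ} (h : γ =ᶠ[𝓝 t] γ') : vel γ t = vel γ' t :=
  velocity_congr h

theorem vel_eventuallyEq {γ γ' : ℝ → X} {t : ℝ} (h : γ =ᶠ[𝓝 t] γ') : vel γ =ᶠ[𝓝 t] vel γ' :=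
  (eventually_eventually_nhds.2 h).mono fun _ h' => vel_congr h'

theorem contMDiffOn_vel {γ : ℝ → X} {O : Set ℝ} (hO : IsOpen O)
    (hγ : ContMDiffOn 𝓘(ℝ, ℝ) X.I ∞ γ O) : ContMDiffOn 𝓘(ℝ, ℝ) X.tangent.I ∞ (vel γ) O := by
  have hc : ContMDiffOn 𝓘(ℝ, ℝ × ℝ) X.I ∞ (fun z : ℝ × ℝ => γ z.1) (O ×ˢ (univ : Set ℝ)) :=
    hγ.comp (ContDiff.contMDiff (f := fun z : ℝ × ℝ => z.1) (by fun_prop)).contMDiffOn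
      fun z hz => hz.1
  exact (contMDiffOn_velocity_fst (hO.prod isOpen_univ) hc).slice_fst (mem_univ (0 : ℝ))

theorem IsGeodesicOn.congr {γ γ' : ℝ → X} {O : Set ℝ} (hO : IsOpen O) (h : IsGeodesicOn p S γ O)
    (he : EqOn γ' γ O) : IsGeodesicOn p S γ' O := by
  have hev : ∀ t ∈ O, γ' =ᶠ[𝓝 t] γ := fun t ht => he.eventuallyEq_of_mem (hO.mem_nhds ht)
  refine ⟨h.smooth.congr he, fun t ht => ?_, fun t ht => ?_⟩
  · rw [vel_congr (hev t ht)]; exact h.regular t ht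
  · rw [vel_congr (X := X.tangent) (vel_eventuallyEq (hev t ht)), vel_congr (hev t ht)]
    exact h.eq t ht

/-- The variation field of a geodesic variation is a Jacobi field. -/
theorem IsGeodesicVariationOn.isJacobiFieldOn [T2Space B] (hp : ContMDiff X.I B.I ∞ p)
    (hS : IsSpray p S) {γ : ℝ → X} {O : Set ℝ} (hO : IsOpen O) {ε : ℝ} (hε : 0 < ε)
    {V : ℝ × ℝ → X} (hV : IsGeodesicVariationOn p S γ O ε V) :
    IsJacobiFieldOn p S γ (fun t => vel (fun s => V (t, s)) 0) O := by
  have h0 : (0 : ℝ) ∈ Ioo (-ε) ε := ⟨by linarith, hε⟩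
  have hW : IsOpen (O ×ˢ Ioo (-ε) ε) := hO.prod isOpen_Ioo
  have hγ : IsGeodesicOn p S γ O := (hV.geodesic 0 h0).congr hO fun t ht => (hV.base t ht).symm
  set J : ℝ → X.tangent := fun t => vel (fun s => V (t, s)) 0 with hJ
  let T : ℝ × ℝ → X.tangent := fun z => vel (fun t => V (t, z.2)) z.1
  have hT : ContMDiffOn 𝓘(ℝ, ℝ × ℝ) X.tangent.I ∞ T (O ×ˢ Ioo (-ε) ε) :=
    contMDiffOn_velocity_fst hW hV.smooth
  have hJs : ContMDiffOn 𝓘(ℝ, ℝ) X.tangent.I ∞ J O :=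
    (contMDiffOn_velocity_snd hW hV.smooth).slice_fst h0
  have hJd : ∀ t ∈ O, MDifferentiableAt 𝓘(ℝ, ℝ) X.tangent.I J t := fun t ht =>
    (hJs.contMDiffAt (hO.mem_nhds ht)).mdifferentiableAt (by simp)
  have hproj : ∀ t ∈ O, X.proj (J t) = γ t := fun t ht => hV.base t ht
  have hreg : ∀ t ∈ O, vel J t ∈ slashed (p ∘ X.proj) := by
    intro t ht
    -- Regularity of `J` is regularity of its base curve, since D(p ∘ π)(J') = Dp(γ').
    have h1 : D (p ∘ X.proj) (vel J t) = D p (vel γ t) := by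
      have h2 : D (p ∘ X.proj) (vel J t) = D p (D X.proj (vel J t)) :=
        D_comp (hp.mdifferentiable (by simp) _) ((contMDiff_proj X).mdifferentiable (by simp) _)
      have h3 := vel_comp (X := X.tangent) (Y := X) (f := X.proj)
        ((contMDiff_proj X).mdifferentiable (by simp) _) (hJd t ht)
      rw [h2, ← h3]
      congr 1
      exact vel_congr (Filter.mem_of_superset (hO.mem_nhds ht) hproj)
    have h4 := hγ.regular t ht
    unfold slashed at h4 ⊢
    rw [mem_ofPred_eq] at h4 ⊢
    rw [h1]
    exact h4
  have hat : ∀ t ∈ O, O ×ˢ Ioo (-ε) ε ∈ 𝓝 (t, (0 : ℝ)) := fun t ht => hW.mem_nhds ⟨ht, h0⟩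
  have hTJ : ∀ t ∈ O, vel J t = X.flip (vel (fun s => T (t, s)) 0) := fun t ht =>
    flip_vel_vel (hV.smooth.contMDiffAt (hat t ht))
  have hTs : ∀ t ∈ O, MDifferentiableAt 𝓘(ℝ, ℝ) X.tangent.I (fun s => T (t, s)) 0 := fun t ht =>
    ((hT.slice_snd ht).contMDiffAt (isOpen_Ioo.mem_nhds h0)).mdifferentiableAt (by simp)
  -- The geodesic equation ∂ₜT = S ∘ T, differentiated in s at s = 0.
  have hVT : ∀ t ∈ O, vel (fun s => vel (fun t' => T (t', s)) t) 0 =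
      D S (vel (fun s => T (t, s)) 0) := by
    intro t ht
    have hm : T (t, 0) ∈ slashed p := (hV.geodesic 0 h0).regular t ht
    rw [← vel_comp (((hS.smooth.contMDiffAt ((isOpen_slashed hp).mem_nhds hm))).mdifferentiableAt
      (by simp)) (hTs t ht)]
    refine vel_congr ?_
    filter_upwards [isOpen_Ioo.mem_nhds h0] with s hs using (hV.geodesic s hs).eq t ht
  refine ⟨hγ, ⟨hJs, hreg, fun t ht => ?_⟩, hproj⟩
  have e1 : X.flip (vel J t) = vel (fun s => T (t, s)) 0 := by rw [hTJ t ht, flip_flip]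
  have e2 : vel (fun t' => vel (fun s => T (t', s)) 0) t =
      X.tangent.flip (D S (X.flip (vel J t))) := by
    rw [e1, ← hVT t ht]
    exact flip_vel_vel (hT.contMDiffAt (hat t ht))
  have hTd : MDifferentiableAt 𝓘(ℝ, ℝ) X.tangent.tangent.I (fun t' => vel (fun s => T (t', s)) 0) t :=
    (((contMDiffOn_velocity_snd hW hT).slice_fst h0).contMDiffAt
      (hO.mem_nhds ht)).mdifferentiableAt (by simp)
  have e3 : vel (vel J) t = D X.flip (vel (fun t' => vel (fun s => T (t', s)) 0) t) := by
    rw [← vel_comp ((contMDiff_flip X).mdifferentiable (by simp) _) hTd]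
    exact vel_congr (Filter.mem_of_superset (hO.mem_nhds ht) hTJ)
  rw [e3, e2]
  rfl

/-- Jacobi fields are variation fields of geodesic variations near compact intervals. -/
theorem IsJacobiFieldOn.exists_variation [T2Space X] [T2Space B] (hp : ContMDiff X.I B.I ∞ p)
    (hS : IsSpray p S) {γ : ℝ → X} {J : ℝ → X.tangent} {O : Set ℝ} (hO : IsOpen O)
    (hOc : O.OrdConnected) (hJ : IsJacobiFieldOn p S γ J O) {a b : ℝ} (ha : a ∈ O) (hb : b ∈ O) :
    ∃ (O' : Set ℝ) (ε : ℝ) (V : ℝ × ℝ → X), IsOpen O' ∧ O'.OrdConnected ∧ O' ⊆ O ∧ a ∈ O' ∧ b ∈ O' ∧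
      0 < ε ∧ IsGeodesicVariationOn p S γ O' ε V ∧
      ∀ t ∈ O', J t = vel (fun s => V (t, s)) 0 := by
  have hγs := hJ.geodesic.smooth
  have hσd : ∀ t ∈ O, MDifferentiableAt 𝓘(ℝ, ℝ) X.tangent.I (vel γ) t := fun t ht =>
    ((contMDiffOn_vel hO hγs).contMDiffAt (hO.mem_nhds ht)).mdifferentiableAt (by simp)
  have hJd : ∀ t ∈ O, MDifferentiableAt 𝓘(ℝ, ℝ) X.tangent.I J t := fun t ht =>
    (hJ.lift.smooth.contMDiffAt (hO.mem_nhds ht)).mdifferentiableAt (by simp)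
  -- The curve s ↦ ∂ₜV(a, s) of the desired variation must have velocity κ(J'(a)) at s = 0; `w`
  -- prescribes it.
  obtain ⟨w, ε₀, hε₀, hw, hw0, hwv⟩ := exists_curve_velocity_eq (I := X.tangent.I)
    (X.flip (vel J a))
  have hw0' : w 0 = vel γ a := by
    have h1 : w 0 = X.tangent.proj (X.flip (vel J a)) := hw0
    have h3 := vel_comp (X := X.tangent) (Y := X) (f := X.proj)
      ((contMDiff_proj X).mdifferentiable (by simp) _) (hJd a ha)
    rw [h1, proj_flip, ← h3]
    exact vel_congr (Filter.mem_of_superset (hO.mem_nhds ha) hJ.proj_eq)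
  obtain ⟨O', ε, c, hO', hOc', hsub, -, haO, hbO, hε, hle, hc, hcw, hcσ⟩ :=
    exists_integralFamily (I := X.tangent.I) (isOpen_slashed hp) hS.smooth hS.vectorField hO hOc
      hσd hJ.geodesic.regular hJ.geodesic.eq ha hε₀ hw hw0' ha hb
  have h0 : (0 : ℝ) ∈ Ioo (-ε) ε := ⟨by linarith, hε⟩
  let V : ℝ × ℝ → X := fun z => X.proj (c z)
  have hVs : ContMDiffOn 𝓘(ℝ, ℝ × ℝ) X.I ∞ V (O' ×ˢ Ioo (-ε) ε) :=
    (contMDiff_proj X).comp_contMDiffOn hc.smooth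
  have hcd := fun s hs => hc.mdifferentiableAt hO' (s := s) hs
  -- Because S is of second order, each integral curve of S is the velocity of its own projection.
  have hVv : ∀ s ∈ Ioo (-ε) ε, ∀ t ∈ O', vel (fun t' => V (t', s)) t = c (t, s) := by
    intro s hs t ht
    have h1 := vel_comp (X := X.tangent) (Y := X) (f := X.proj)
      ((contMDiff_proj X).mdifferentiable (by simp) _) (hcd s hs t ht)
    have h2 : vel (X := X.tangent) (fun t' => c (t', s)) t = S (c (t, s)) :=
      hc.velocity_eq t ht s hs
    refine h1.trans ?_
    rw [h2]
    exact hS.secondOrder _ (hc.mem t ht s hs)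
  have hV : IsGeodesicVariationOn p S γ O' ε V := by
    refine ⟨hVs, fun t ht => ?_, fun s hs => ⟨hVs.slice_fst hs, fun t ht => ?_, fun t ht => ?_⟩⟩
    · exact congrArg X.proj (hcσ t ht)
    · rw [hVv s hs t ht]; exact hc.mem t ht s hs
    · rw [hVv s hs t ht]
      refine Eq.trans ?_ (hc.velocity_eq t ht s hs)
      exact vel_congr (Filter.mem_of_superset (hO'.mem_nhds ht) (hVv s hs))
  have hJ' := hV.isJacobiFieldOn hp hS hO' hε
  set J' : ℝ → X.tangent := fun t => vel (fun s => V (t, s)) 0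
  have hinit : vel J a = vel J' a := by
    have h1 : vel J' a = X.flip (vel (fun s => vel (fun t => V (t, s)) a) 0) :=
      flip_vel_vel (hVs.contMDiffAt ((hO'.prod isOpen_Ioo).mem_nhds ⟨haO, h0⟩))
    have h2 : vel (fun s => vel (fun t => V (t, s)) a) 0 = X.flip (vel J a) := by
      refine Eq.trans (vel_congr ?_) hwv
      filter_upwards [isOpen_Ioo.mem_nhds h0] with s hs
      rw [hVv s hs a haO, hcw s hs]
    rw [h1, h2, flip_flip]
  have hpp : ContMDiff X.tangent.I B.I ∞ (p ∘ X.proj) := hp.comp (contMDiff_proj X)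
  -- The velocities of both fields are integral curves of S^c with the same value at `a`; projecting
  -- their equality gives equality of the fields.
  have huniq := eqOn_of_velocity_eq (I := X.tangent.tangent.I) (isOpen_slashed hpp)
    (hS.contMDiffOn_completeLift hp) (fun ξ hξ => hS.proj_completeLift hp hξ) hO'
    hOc'.isPreconnected (c₁ := vel J) (c₂ := vel J')
    (fun t ht => ((contMDiffOn_vel hO hJ.lift.smooth).contMDiffAt
      (hO.mem_nhds (hsub ht))).mdifferentiableAt (by simp))
    (fun t ht => ((contMDiffOn_vel hO' hJ'.lift.smooth).contMDiffAt
      (hO'.mem_nhds ht)).mdifferentiableAt (by simp))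
    (fun t ht => hJ.lift.regular t (hsub ht))
    (fun t ht => hJ.lift.eq t (hsub ht)) (fun t ht => hJ'.lift.eq t ht) haO hinit
  exact ⟨O', ε, V, hO', hOc', hsub, haO, hbO, hε, hV,
    fun t ht => congrArg X.tangent.proj (huniq ht)⟩

theorem isJacobiField_of_variation [T2Space B] (hp : ContMDiff X.I B.I ∞ p) (hS : IsSpray p S)
    {γ : ℝ → X} {J : ℝ → X.tangent} {I : Set ℝ} {ε : ℝ} {V : ℝ × ℝ → X} (hε : 0 < ε)
    (hV : IsGeodesicVariation p S γ I ε V) (hJ : ∀ t ∈ I, J t = vel (fun s => V (t, s)) 0) :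
    IsJacobiField p S γ J I := by
  rcases hV with ⟨hI, hV⟩ | ⟨hI, I', γ', ε', V', hI', hoc, hsub, hε', hγ, hVV, hV'⟩
  · have h := hV.isJacobiFieldOn hp hS hI hε
    exact Or.inl ⟨hI, h.geodesic, h.lift.congr hI hJ,
      fun t ht => (congrArg X.proj (hJ t ht)).trans (h.proj_eq t ht)⟩
  · refine Or.inr ⟨hI, I', γ', _, hI', hoc, hsub, hγ, fun t ht => ?_,
      hV'.isJacobiFieldOn hp hS hI' hε'⟩
    rw [hJ t ht]
    -- Only the values for small s matter, and for |s| below both `ε` and `ε'` the two maps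
    -- coincide.
    refine vel_congr ?_
    filter_upwards [Ioo_mem_nhds (neg_lt_zero.2 hε) hε, Ioo_mem_nhds (neg_lt_zero.2 hε') hε']
      with s h1 h2 using hVV ⟨ht, h1, h2⟩

theorem exists_variation_of_isJacobiField [T2Space X] [T2Space B] (hp : ContMDiff X.I B.I ∞ p)
    (hS : IsSpray p S) {γ : ℝ → X} {J : ℝ → X.tangent} {I : Set ℝ} (hI : I.OrdConnected)
    (hne : I.Nonempty) (hc : IsCompact I) (hJ : IsJacobiField p S γ J I) :
    ∃ (ε : ℝ) (V : ℝ × ℝ → X), 0 < ε ∧ IsGeodesicVariation p S γ I ε V ∧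
      ∀ t ∈ I, J t = vel (fun s => V (t, s)) 0 := by
  have hext : ∃ (I' : Set ℝ) (γ' : ℝ → X) (J' : ℝ → X.tangent), IsOpen I' ∧ I'.OrdConnected ∧
      I ⊆ I' ∧ EqOn γ γ' I ∧ EqOn J J' I ∧ IsJacobiFieldOn p S γ' J' I' := by
    rcases hJ with ⟨ho, hJ⟩ | ⟨-, h⟩
    · exact ⟨I, γ, J, ho, hI, Subset.rfl, fun _ _ => rfl, fun _ _ => rfl, hJ⟩
    · exact h
  obtain ⟨I', γ', J', ho, hoc, hsub, hγ, hJJ, hJ'⟩ := hext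
  -- The infimum and supremum of `I` lie in `I`; an interval containing both contains `I`.
  obtain ⟨O, ε, V, hO, hOc, -, ha, hb, hε, hV, hVJ⟩ := hJ'.exists_variation hp hS ho hoc
    (hsub (hc.sInf_mem hne)) (hsub (hc.sSup_mem hne))
  have hsubO : I ⊆ O := fun t ht =>
    hOc.out ha hb ⟨csInf_le hc.bddBelow ht, le_csSup hc.bddAbove ht⟩
  exact ⟨ε, V, hε, Or.inr ⟨hc.isClosed, O, γ', ε, V, hO, hOc, hsubO, hε, hγ, fun _ _ => rfl, hV⟩,
    fun t ht => (hJJ ht).trans (hVJ t (hsubO ht))⟩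

end Mfd

end

theorem mainTheorem8 (n : ℕ) (hn : 1 ≤ n) (M : Type u) [TopologicalSpace M]
    [ChartedSpace (EuclideanSpace ℝ (Fin n)) M] [IsManifold (𝓡 n) ∞ M] [T2Space M]
    [SecondCountableTopology M] (r : ℕ)
    (S : ((Mfd.of n M).iter r).tangent → ((Mfd.of n M).iter r).tangent.tangent)
    (hS : Mfd.IsSpray ((Mfd.of n M).toBase r) S)
    (I : Set ℝ) (hI : I.OrdConnected) (hne : I.Nonempty) (hoc : IsOpen I ∨ IsClosed I)
    (J : ℝ → ((Mfd.of n M).iter r).tangent) (γ : ℝ → (Mfd.of n M).iter r)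
    (hγ : ∀ t ∈ I, γ t = ((Mfd.of n M).iter r).proj (J t)) :
    ((∃ (ε : ℝ) (V : ℝ × ℝ → (Mfd.of n M).iter r), 0 < ε ∧
        Mfd.IsGeodesicVariation ((Mfd.of n M).toBase r) S γ I ε V ∧
        ∀ t ∈ I, J t = Mfd.vel (fun s => V (t, s)) 0) →
      Mfd.IsJacobiField ((Mfd.of n M).toBase r) S γ J I) ∧
    (Mfd.IsJacobiField ((Mfd.of n M).toBase r) S γ J I → IsCompact I →
      ∃ (ε : ℝ) (V : ℝ × ℝ → (Mfd.of n M).iter r), 0 < ε ∧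
        Mfd.IsGeodesicVariation ((Mfd.of n M).toBase r) S γ I ε V ∧
        ∀ t ∈ I, J t = Mfd.vel (fun s => V (t, s)) 0) := by
  have : T2Space (Mfd.of n M) := inferInstanceAs (T2Space M)
  have : T2Space ((Mfd.of n M).iter r) := Mfd.t2Space_iter _ r
  have hp := Mfd.contMDiff_toBase (Mfd.of n M) r
  exact ⟨fun ⟨_, _, hε, hV, hJ⟩ => Mfd.isJacobiField_of_variation hp hS hε hV hJ,
    fun hJ hc => Mfd.exists_variation_of_isJacobiField hp hS hI hne hc hJ⟩
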